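/- Let $R$ be a commutative ring with unity and let $C$ be an $R$-coalgebra that is flat as an $R$-module; $\otimes=\otimes_R$. For a right $C$-comodule $M$ and a left $C$-comodule $N$ let $M\square_C N=\ker(\varrho_M\otimes id_N-id_M\otimes\varrho_N)\subseteq M\otimes N$ be the cotensor product. Let $X$ be a right $C$-comodule which is * quasi-finite: the functor $-\otimes X$ from $R$-modules to right $C$-comodules has a left adjoint $h=h_C(X,-)$, with unit $\eta_M: M\to h(M)\otimes X$; * faithfully coflat: the functor $X\square_C-$ from left $C$-comodules to $R$-modules is exact and faithful; * an injector: the functor $-\otimes X$ maps injective $R$-modules to injective right $C$-comodules. Let $E=e_C(X)=h_C(X,X)$ be the coendomorphism coalgebra: its comultiplication and counit are the unique linear maps with $(\Delta\otimes id)\eta_X=(id\otimes\eta_X)\eta_X$ and $(\varepsilon\otimes id)\eta_X=(X\cong R\otimes X)$. Then $X$ is an $E$-$C$-bicomodule with left coaction $\eta_X$, and $h_C(X,C)$ is a $C$-$E$-bicomodule, whose left and right coactions $\varrho^-,\varrho^+$ are determined by $(\varrho^-\otimes id)\eta_C=(id\otimes\eta_C)\Delta_C$ and $(\varrho^+\otimes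 id)\eta_C=(id\otimes\eta_X)\eta_C$. Let $\delta_X: E\to X\square_C h_C(X,C)$ be the unique linear map with $(\delta_X\otimes id)\eta_X=(id\otimes\eta_C)\varrho_X$, and regard $\eta_C$ as a map $C\to h_C(X,C)\square_E X$. Then, for every choice of the left adjoint $h$, $(E,\,C,\,X,\,h_C(X,C),\,\delta_X,\,\eta_C)$ is a strict Morita–Takeuchi context. Here a strict Morita–Takeuchi context $(D,C,M,N,f,g)$ consists of $R$-flat coalgebras $D$, $C$, a $D$-$C$-bicomodule $M$ and a $C$-$D$-bicomodule $N$ and bijective bicomodule morphisms $f:D\to M\square_C N$, $g:C\to N\square_D M$ such that 1. $M$ and $N$ are flat $R$-modules; 2. $M\square_C N$ is pure in $M\otimes N$ and $N\square_D M$ is pure in $N\otimes M$; 3. the two maps $M\cong M\square_C C\xrightarrow{id\,\square\, g}M\square_C N\square_D M$ and $M\cong D\square_D M\xrightarrow{f\,\square\, id}M\square_C N\square_D M$ agree, and so do $N\cong N\square_D D\xrightarrow{id\,\square\, f}N\square_D M\square_C N$ and $N\cong C\square_C N\xrightarrow{g\,\square\, id}N\square_D M\square_C N$. Consequently $C$ is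 Morita–Takeuchi equivalent to $e_C(X)$: the categories of right comodules over $C$ and over $e_C(X)$ are equivalent, by an $R$-linear equivalence. -/

import Mathlib

open CategoryTheory TensorProduct

universe u

noncomputable section

namespace MoritaTakeuchi

/-! ## Comodules and bicomodules -/

/-- A right comodule over the `R`-coalgebra `C`. -/
structure RComod (R C : Type u) [CommRing R] [AddCommGroup C] [Module R C] [Coalgebra R C] where
  carrier : Type u
  [addCommGroup : AddCommGroup carrier]
  [module : Module R carrier]
  rcoact : carrier →ₗ[R] carrier ⊗[R] C
  rcoassoc : TensorProduct.assoc R carrier C C ∘ₗ rcoact.rTensor C ∘ₗ rcoact =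
    (Coalgebra.comul (R := R) (A := C)).lTensor carrier ∘ₗ rcoact
  rcounit : (Coalgebra.counit (R := R) (A := C)).lTensor carrier ∘ₗ rcoact =
    (TensorProduct.mk R carrier R).flip 1

/-- A left comodule over the `R`-coalgebra `C`. -/
structure LComod (R C : Type u) [CommRing R] [AddCommGroup C] [Module R C] [Coalgebra R C] where
  carrier : Type u
  [addCommGroup : AddCommGroup carrier]
  [module : Module R carrier]
  lcoact : carrier →ₗ[R] C ⊗[R] carrier
  lcoassoc : TensorProduct.assoc R C C carrier ∘ₗ
      (Coalgebra.comul (R := R) (A := C)).rTensor carrier ∘ₗ lcoact =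
    lcoact.lTensor C ∘ₗ lcoact
  lcounit : (Coalgebra.counit (R := R) (A := C)).rTensor carrier ∘ₗ lcoact =
    TensorProduct.mk R R carrier 1

attribute [instance] RComod.addCommGroup RComod.module LComod.addCommGroup LComod.module

/-- A `D`-`C`-bicomodule: a left `D`-comodule and right `C`-comodule whose coactions commute. -/
structure Bicomod (R D C : Type u) [CommRing R] [AddCommGroup D] [Module R D] [Coalgebra R D]
    [AddCommGroup C] [Module R C] [Coalgebra R C] extends LComod R D, RComod R C where
  coact_comm : TensorProduct.assoc R D carrier C ∘ₗ lcoact.rTensor C ∘ₗ rcoact =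
    rcoact.lTensor D ∘ₗ lcoact

section Categories

variable {R C : Type u} [CommRing R] [AddCommGroup C] [Module R C] [Coalgebra R C]

/-- The `R`-module of colinear maps between right comodules. -/
def RComod.colinear (M N : RComod R C) : Submodule R (M.carrier →ₗ[R] N.carrier) where
  carrier := {f | N.rcoact ∘ₗ f = f.rTensor C ∘ₗ M.rcoact}
  add_mem' {f g} hf hg := by
    simp only [Set.mem_ofPred_eq] at *
    rw [LinearMap.comp_add, hf, hg, LinearMap.rTensor_add, LinearMap.add_comp]
  zero_mem' := by simp
  smul_mem' r f hf := by
    simp only [Set.mem_ofPred_eq] at *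
    rw [LinearMap.comp_smul, hf, LinearMap.rTensor_smul, LinearMap.smul_comp]

/-- The `R`-module of colinear maps between left comodules. -/
def LComod.colinear (M N : LComod R C) : Submodule R (M.carrier →ₗ[R] N.carrier) where
  carrier := {f | N.lcoact ∘ₗ f = f.lTensor C ∘ₗ M.lcoact}
  add_mem' {f g} hf hg := by
    simp only [Set.mem_ofPred_eq] at *
    rw [LinearMap.comp_add, hf, hg, LinearMap.lTensor_add, LinearMap.add_comp]
  zero_mem' := by simp
  smul_mem' r f hf := by
    simp only [Set.mem_ofPred_eq] at *
    rw [LinearMap.comp_smul, hf, LinearMap.lTensor_smul, LinearMap.smul_comp]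

theorem RComod.mem_colinear {M N : RComod R C} {f : M.carrier →ₗ[R] N.carrier} :
    f ∈ RComod.colinear M N ↔ N.rcoact ∘ₗ f = f.rTensor C ∘ₗ M.rcoact := Iff.rfl

theorem LComod.mem_colinear {M N : LComod R C} {f : M.carrier →ₗ[R] N.carrier} :
    f ∈ LComod.colinear M N ↔ N.lcoact ∘ₗ f = f.lTensor C ∘ₗ M.lcoact := Iff.rfl

theorem RComod.comp_mem {M N P : RComod R C} {f : M.carrier →ₗ[R] N.carrier}
    {g : N.carrier →ₗ[R] P.carrier} (hg : g ∈ RComod.colinear N P)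
    (hf : f ∈ RComod.colinear M N) : g ∘ₗ f ∈ RComod.colinear M P := by
  rw [RComod.mem_colinear] at *
  rw [← LinearMap.comp_assoc, hg, LinearMap.comp_assoc, hf, LinearMap.rTensor_comp,
    LinearMap.comp_assoc]

theorem LComod.comp_mem {M N P : LComod R C} {f : M.carrier →ₗ[R] N.carrier}
    {g : N.carrier →ₗ[R] P.carrier} (hg : g ∈ LComod.colinear N P)
    (hf : f ∈ LComod.colinear M N) : g ∘ₗ f ∈ LComod.colinear M P := by
  rw [LComod.mem_colinear] at *
  rw [← LinearMap.comp_assoc, hg, LinearMap.comp_assoc, hf, LinearMap.lTensor_comp,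
    LinearMap.comp_assoc]

theorem RComod.id_mem (M : RComod R C) : LinearMap.id ∈ RComod.colinear M M := by
  simp [RComod.mem_colinear]

theorem LComod.id_mem (M : LComod R C) : LinearMap.id ∈ LComod.colinear M M := by
  simp [LComod.mem_colinear]

/-- The category of right `C`-comodules and colinear maps. -/
instance RComod.category : Category.{u} (RComod R C) where
  Hom M N := RComod.colinear M N
  id M := ⟨LinearMap.id, RComod.id_mem M⟩
  comp f g := ⟨g.1 ∘ₗ f.1, RComod.comp_mem g.2 f.2⟩

/-- The category of left `C`-comodules and colinear maps. -/
instance LComod.category : Category.{u} (LComod R C) where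
  Hom M N := LComod.colinear M N
  id M := ⟨LinearMap.id, LComod.id_mem M⟩
  comp f g := ⟨g.1 ∘ₗ f.1, LComod.comp_mem g.2 f.2⟩

/-- The linear map underlying a morphism of right comodules. -/
def RComod.lin {M N : RComod R C} (f : M ⟶ N) : M.carrier →ₗ[R] N.carrier := f.1

/-- The linear map underlying a morphism of left comodules. -/
def LComod.lin {M N : LComod R C} (f : M ⟶ N) : M.carrier →ₗ[R] N.carrier := f.1

instance RComod.preadditive : Preadditive (RComod R C) where
  homGroup M N := inferInstanceAs (AddCommGroup (RComod.colinear M N))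
  add_comp _ _ _ f f' g := Subtype.ext (LinearMap.comp_add f.1 f'.1 g.1)
  comp_add _ _ _ f g g' := Subtype.ext (LinearMap.add_comp f.1 g'.1 g.1)

instance RComod.linear : CategoryTheory.Linear R (RComod R C) where
  homModule M N := inferInstanceAs (Module R (RComod.colinear M N))
  smul_comp _ _ _ r f g := Subtype.ext (LinearMap.comp_smul g.1 r f.1)
  comp_smul _ _ _ f r g := Subtype.ext (LinearMap.smul_comp r g.1 f.1)

variable (R C) in
/-- `C` as a `C`-`C`-bicomodule through its comultiplication. -/
abbrev Bicomod.self : Bicomod R C C where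
  carrier := C
  lcoact := Coalgebra.comul
  lcoassoc := Coalgebra.coassoc
  lcounit := Coalgebra.rTensor_counit_comp_comul
  rcoact := Coalgebra.comul
  rcoassoc := Coalgebra.coassoc
  rcounit := Coalgebra.lTensor_counit_comp_comul
  coact_comm := Coalgebra.coassoc

/-- For an `R`-module `W` and a right comodule `X`, the right comodule `W ⊗ X` with coaction
`id ⊗ ρ`. -/
abbrev RComod.tensorObj (W : Type u) [AddCommGroup W] [Module R W] (X : RComod R C) :
    RComod R C where
  carrier := W ⊗[R] X.carrier
  rcoact := (TensorProduct.assoc R W X.carrier C).symm ∘ₗ X.rcoact.lTensor W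
  rcoassoc := by
    refine TensorProduct.ext' fun w x => ?_
    have h := LinearMap.congr_fun X.rcoassoc x
    simp only [LinearMap.comp_apply, LinearEquiv.coe_coe, LinearMap.lTensor_tmul] at h ⊢
    have h1 : ∀ t : X.carrier ⊗[R] C,
        (TensorProduct.assoc R (W ⊗[R] X.carrier) C C)
          (((TensorProduct.assoc R W X.carrier C).symm.toLinearMap ∘ₗ X.rcoact.lTensor W).rTensor C
            ((TensorProduct.assoc R W X.carrier C).symm (w ⊗ₜ t))) =
        (TensorProduct.assoc R W X.carrier (C ⊗[R] C)).symm
          (w ⊗ₜ (TensorProduct.assoc R X.carrier C C) (X.rcoact.rTensor C t)) := by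
      intro t
      induction t with
      | zero => simp
      | add a b ha hb => simp only [tmul_add, map_add, ha, hb]
      | tmul a c =>
        simp only [assoc_symm_tmul, LinearMap.rTensor_tmul, LinearMap.comp_apply,
          LinearMap.lTensor_tmul, LinearEquiv.coe_coe]
        induction X.rcoact a with
        | zero => simp
        | add a b ha hb => simp only [tmul_add, add_tmul, map_add, ha, hb]
        | tmul a d => simp
    have h2 : ∀ t : X.carrier ⊗[R] C,
        (Coalgebra.comul (R := R) (A := C)).lTensor (W ⊗[R] X.carrier)
            ((TensorProduct.assoc R W X.carrier C).symm (w ⊗ₜ t)) =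
        (TensorProduct.assoc R W X.carrier (C ⊗[R] C)).symm
          (w ⊗ₜ ((Coalgebra.comul (R := R) (A := C)).lTensor X.carrier t)) := by
      intro t
      induction t with
      | zero => simp
      | add a b ha hb => simp only [tmul_add, map_add, ha, hb]
      | tmul a c => simp
    rw [h1, h2, h]
  rcounit := by
    refine TensorProduct.ext' fun w x => ?_
    have h := LinearMap.congr_fun X.rcounit x
    simp only [LinearMap.comp_apply, LinearEquiv.coe_coe, LinearMap.lTensor_tmul,
      LinearMap.flip_apply, TensorProduct.mk_apply] at h ⊢
    have h2 : ∀ t : X.carrier ⊗[R] C,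
        (Coalgebra.counit (R := R) (A := C)).lTensor (W ⊗[R] X.carrier)
            ((TensorProduct.assoc R W X.carrier C).symm (w ⊗ₜ t)) =
        (TensorProduct.assoc R W X.carrier R).symm
          (w ⊗ₜ ((Coalgebra.counit (R := R) (A := C)).lTensor X.carrier t)) := by
      intro t
      induction t with
      | zero => simp
      | add a b ha hb => simp only [tmul_add, map_add, ha, hb]
      | tmul a c => simp
    rw [h2, h, assoc_symm_tmul]

/-- For an `R`-module `W` and a left comodule `X`, the left comodule `X ⊗ W` with coaction
`ρ ⊗ id`. -/
abbrev LComod.tensorObj (X : LComod R C) (W : Type u) [AddCommGroup W] [Module R W] :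
    LComod R C where
  carrier := X.carrier ⊗[R] W
  lcoact := (TensorProduct.assoc R C X.carrier W) ∘ₗ X.lcoact.rTensor W
  lcoassoc := by
    refine TensorProduct.ext' fun x w => ?_
    have h := LinearMap.congr_fun X.lcoassoc x
    simp only [LinearMap.comp_apply, LinearEquiv.coe_coe, LinearMap.rTensor_tmul] at h ⊢
    have h1 : ∀ t : C ⊗[R] X.carrier,
        (((TensorProduct.assoc R C X.carrier W).toLinearMap ∘ₗ X.lcoact.rTensor W).lTensor C
            ((TensorProduct.assoc R C X.carrier W) (t ⊗ₜ w))) =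
        (TensorProduct.assoc R C C (X.carrier ⊗[R] W))
          ((TensorProduct.assoc R (C ⊗[R] C) X.carrier W)
          (((TensorProduct.assoc R C C X.carrier).symm (X.lcoact.lTensor C t)) ⊗ₜ w)) := by
      intro t
      induction t with
      | zero => simp
      | add a b ha hb => simp only [add_tmul, map_add, ha, hb]
      | tmul c a =>
        simp only [assoc_tmul, LinearMap.lTensor_tmul, LinearMap.comp_apply,
          LinearMap.rTensor_tmul, LinearEquiv.coe_coe]
        induction X.lcoact a with
        | zero => simp
        | add a b ha hb => simp only [tmul_add, add_tmul, map_add, ha, hb]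
        | tmul a d => simp
    have h2 : ∀ t : C ⊗[R] X.carrier,
        (Coalgebra.comul (R := R) (A := C)).rTensor (X.carrier ⊗[R] W)
            ((TensorProduct.assoc R C X.carrier W) (t ⊗ₜ w)) =
        (TensorProduct.assoc R (C ⊗[R] C) X.carrier W)
          (((Coalgebra.comul (R := R) (A := C)).rTensor X.carrier t) ⊗ₜ w) := by
      intro t
      induction t with
      | zero => simp
      | add a b ha hb => simp only [add_tmul, map_add, ha, hb]
      | tmul a c => simp
    rw [h1, h2, ← h, LinearEquiv.symm_apply_apply]
  lcounit := by
    refine TensorProduct.ext' fun x w => ?_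
    have h := LinearMap.congr_fun X.lcounit x
    simp only [LinearMap.comp_apply, LinearEquiv.coe_coe, LinearMap.rTensor_tmul,
      TensorProduct.mk_apply] at h ⊢
    have h2 : ∀ t : C ⊗[R] X.carrier,
        (Coalgebra.counit (R := R) (A := C)).rTensor (X.carrier ⊗[R] W)
            ((TensorProduct.assoc R C X.carrier W) (t ⊗ₜ w)) =
        (TensorProduct.assoc R R X.carrier W)
          (((Coalgebra.counit (R := R) (A := C)).rTensor X.carrier t) ⊗ₜ w) := by
      intro t
      induction t with
      | zero => simp
      | add a b ha hb => simp only [add_tmul, map_add, ha, hb]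
      | tmul a c => simp
    rw [h2, h, assoc_tmul]

theorem RComod.rTensor_mem {W V : Type u} [AddCommGroup W] [Module R W] [AddCommGroup V]
    [Module R V] (f : W →ₗ[R] V) (X : RComod R C) :
    f.rTensor X.carrier ∈ RComod.colinear (RComod.tensorObj W X) (RComod.tensorObj V X) := by
  rw [RComod.mem_colinear]
  refine TensorProduct.ext' fun w x => ?_
  simp only [RComod.tensorObj, LinearMap.comp_apply, LinearMap.rTensor_tmul,
    LinearMap.lTensor_tmul, LinearEquiv.coe_coe]
  induction X.rcoact x with
  | zero => simp
  | add a b ha hb => simp only [tmul_add, map_add, ha, hb]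
  | tmul a c => simp

theorem RComod.lTensor_mem (W : Type u) [AddCommGroup W] [Module R W] {M N : RComod R C}
    {f : M.carrier →ₗ[R] N.carrier} (hf : f ∈ RComod.colinear M N) :
    f.lTensor W ∈ RComod.colinear (RComod.tensorObj W M) (RComod.tensorObj W N) := by
  rw [RComod.mem_colinear] at *
  refine TensorProduct.ext' fun w x => ?_
  have h := LinearMap.congr_fun hf x
  simp only [RComod.tensorObj, LinearMap.comp_apply, LinearMap.lTensor_tmul,
    LinearEquiv.coe_coe] at h ⊢
  rw [h]
  induction M.rcoact x with
  | zero => simp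
  | add a b ha hb => simp only [tmul_add, map_add, ha, hb]
  | tmul a c => simp

theorem RComod.assoc_symm_mem (W V : Type u) [AddCommGroup W] [Module R W] [AddCommGroup V]
    [Module R V] (X : RComod R C) :
    (TensorProduct.assoc R W V X.carrier).symm.toLinearMap ∈
      RComod.colinear (RComod.tensorObj W (RComod.tensorObj V X))
        (RComod.tensorObj (W ⊗[R] V) X) := by
  rw [RComod.mem_colinear]
  refine TensorProduct.ext' fun w t => ?_
  change V ⊗[R] X.carrier at t
  induction t with
  | zero => simp
  | add a b ha hb => simp only [tmul_add, map_add, ha, hb]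
  | tmul v x =>
    simp only [RComod.tensorObj, LinearMap.comp_apply, LinearMap.lTensor_tmul,
      LinearEquiv.coe_coe, assoc_symm_tmul]
    induction X.rcoact x with
    | zero => simp
    | add a b ha hb => simp only [tmul_add, map_add, ha, hb]
    | tmul a c => simp

theorem RComod.rcoact_mem (M : RComod R C) :
    M.rcoact ∈ RComod.colinear M
      (RComod.tensorObj M.carrier (Bicomod.self R C).toRComod) := by
  rw [RComod.mem_colinear]
  refine LinearMap.ext fun x => ?_
  have h := LinearMap.congr_fun M.rcoassoc x
  simp only [RComod.tensorObj, Bicomod.self, LinearMap.comp_apply, LinearEquiv.coe_coe] at h ⊢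
  rw [← h, LinearEquiv.symm_apply_apply]

/-- The functor `- ⊗ X` from `R`-modules to right `C`-comodules. -/
def tensorFunctor (X : RComod R C) : ModuleCat.{u} R ⥤ RComod R C where
  obj W := RComod.tensorObj W X
  map f := ⟨f.hom.rTensor X.carrier, RComod.rTensor_mem f.hom X⟩
  map_id W := Subtype.ext (LinearMap.rTensor_id X.carrier W)
  map_comp f g := Subtype.ext (LinearMap.rTensor_comp X.carrier g.hom f.hom)

/-! ## Cotensor product, coflatness, quasi-finiteness, injectors -/

/-- The cotensor product: the kernel of `ρ_M ⊗ id - id ⊗ ρ_N : M ⊗ N → M ⊗ (C ⊗ N)`. -/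
def cotensor (M : RComod R C) (N : LComod R C) : Submodule R (M.carrier ⊗[R] N.carrier) :=
  LinearMap.ker ((TensorProduct.assoc R M.carrier C N.carrier).toLinearMap ∘ₗ
    M.rcoact.rTensor N.carrier - N.lcoact.lTensor M.carrier)

theorem mem_cotensor {M : RComod R C} {N : LComod R C} {t : M.carrier ⊗[R] N.carrier} :
    t ∈ cotensor M N ↔ TensorProduct.assoc R M.carrier C N.carrier
      (M.rcoact.rTensor N.carrier t) = N.lcoact.lTensor M.carrier t := by
  simp [cotensor, sub_eq_zero]

theorem cotensor_map_mem (X : RComod R C) {N P : LComod R C} (f : N ⟶ P)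
    (t : X.carrier ⊗[R] N.carrier) (ht : t ∈ cotensor X N) :
    (LComod.lin f).lTensor X.carrier t ∈ cotensor X P := by
  rw [mem_cotensor] at *
  have hf : P.lcoact ∘ₗ LComod.lin f = (LComod.lin f).lTensor C ∘ₗ N.lcoact := f.2
  have h1 : ∀ s : X.carrier ⊗[R] N.carrier,
      TensorProduct.assoc R X.carrier C P.carrier
        (X.rcoact.rTensor P.carrier ((LComod.lin f).lTensor X.carrier s)) =
      ((LComod.lin f).lTensor C).lTensor X.carrier
        (TensorProduct.assoc R X.carrier C N.carrier (X.rcoact.rTensor N.carrier s)) := by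
    intro s
    induction s with
    | zero => simp
    | add a b ha hb => simp only [map_add, ha, hb]
    | tmul x n =>
      simp only [LinearMap.lTensor_tmul, LinearMap.rTensor_tmul]
      induction X.rcoact x with
      | zero => simp
      | add a b ha hb => simp only [add_tmul, map_add, ha, hb]
      | tmul a c => simp
  rw [h1, ht, ← LinearMap.comp_apply, ← LinearMap.lTensor_comp, ← hf, LinearMap.lTensor_comp,
    LinearMap.comp_apply]

/-- The cotensor functor `X □_C -` from left `C`-comodules to `R`-modules. -/
def cotensorFunctor (X : RComod R C) : LComod R C ⥤ ModuleCat.{u} R where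
  obj N := ModuleCat.of R (cotensor X N)
  map f := ModuleCat.ofHom
    (((LComod.lin f).lTensor X.carrier).restrict (cotensor_map_mem X f))
  map_id N := by
    refine ModuleCat.hom_ext (LinearMap.ext fun t => Subtype.ext ?_)
    exact LinearMap.congr_fun (LinearMap.lTensor_id X.carrier N.carrier) t.1
  map_comp f g := by
    refine ModuleCat.hom_ext (LinearMap.ext fun t => Subtype.ext ?_)
    exact LinearMap.congr_fun
      (LinearMap.lTensor_comp X.carrier (LComod.lin g) (LComod.lin f)) t.1

/-- `X` is coflat: the functor `X □_C -` is exact, i.e. it preserves short exact sequences. (For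
flat `C` a sequence of comodules is exact iff it is exact as a sequence of `R`-modules.) -/
def IsCoflat (X : RComod R C) : Prop :=
  ∀ ⦃N₁ N₂ N₃ : LComod R C⦄ (f : N₁ ⟶ N₂) (g : N₂ ⟶ N₃),
    Function.Injective (LComod.lin f) → Function.Exact (LComod.lin f) (LComod.lin g) →
    Function.Surjective (LComod.lin g) →
      Function.Injective ((cotensorFunctor X).map f).hom ∧
      Function.Exact ((cotensorFunctor X).map f).hom ((cotensorFunctor X).map g).hom ∧
      Function.Surjective ((cotensorFunctor X).map g).hom

/-- `X` is faithfully coflat: the functor `X □_C -` is exact and faithful. -/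
def IsFaithfullyCoflat (X : RComod R C) : Prop :=
  IsCoflat X ∧ (cotensorFunctor X).Faithful

/-- `X` is quasi-finite: the functor `- ⊗ X` from `R`-modules to comodules has a left adjoint. -/
def IsQuasiFinite (X : RComod R C) : Prop := (tensorFunctor X).IsRightAdjoint

/-- `X` is an injector: the functor `- ⊗ X` respects injective objects. -/
def IsInjector (X : RComod R C) : Prop := (tensorFunctor X).PreservesInjectiveObjects

end Categories

/-- Two coalgebras are Morita-Takeuchi equivalent if their categories of right comodules are
equivalent (as `R`-linear categories). -/
def MoritaTakeuchiEquivalent (R C D : Type u) [CommRing R] [AddCommGroup C] [Module R C]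
    [Coalgebra R C] [AddCommGroup D] [Module R D] [Coalgebra R D] : Prop :=
  ∃ e : RComod R C ≌ RComod R D, e.functor.Additive ∧ e.functor.Linear R

/-! ## The cohom functor

In this section `h` is a left adjoint of `- ⊗ X` (the cohom functor `h_C(X,-)`). -/

section Cohom

variable {R C : Type u} [CommRing R] [AddCommGroup C] [Module R C] [Coalgebra R C]
variable {X : RComod R C} {h : RComod R C ⥤ ModuleCat.{u} R} (adj : h ⊣ tensorFunctor X)

/-- The unit of adjunction `η_M : M → h(M) ⊗ X`. -/
def eta (M : RComod R C) : M.carrier →ₗ[R] h.obj M ⊗[R] X.carrier :=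
  RComod.lin (adj.unit.app M)

theorem eta_mem (M : RComod R C) :
    eta adj M ∈ RComod.colinear M (RComod.tensorObj (h.obj M) X) :=
  (adj.unit.app M).2

/-- The linear map `h(M) → W` that corresponds to a colinear map `M → W ⊗ X`. -/
def desc {M : RComod R C} {W : Type u} [AddCommGroup W] [Module R W]
    (f : M.carrier →ₗ[R] W ⊗[R] X.carrier)
    (hf : f ∈ RComod.colinear M (RComod.tensorObj W X)) : h.obj M →ₗ[R] W :=
  ((adj.homEquiv M (ModuleCat.of R W)).symm ⟨f, hf⟩).hom

theorem desc_spec {M : RComod R C} {W : Type u} [AddCommGroup W] [Module R W]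
    (f : M.carrier →ₗ[R] W ⊗[R] X.carrier)
    (hf : f ∈ RComod.colinear M (RComod.tensorObj W X)) :
    (desc adj f hf).rTensor X.carrier ∘ₗ eta adj M = f := by
  have h1 := (adj.homEquiv M (ModuleCat.of R W)).apply_symm_apply ⟨f, hf⟩
  rw [Adjunction.homEquiv_unit] at h1
  exact congrArg Subtype.val h1

theorem desc_apply {M : RComod R C} {W : Type u} [AddCommGroup W] [Module R W]
    (f : M.carrier →ₗ[R] W ⊗[R] X.carrier)
    (hf : f ∈ RComod.colinear M (RComod.tensorObj W X)) (m : M.carrier) :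
    (desc adj f hf).rTensor X.carrier (eta adj M m) = f m :=
  LinearMap.congr_fun (desc_spec adj f hf) m

theorem cohom_ext {M : RComod R C} {W : Type u} [AddCommGroup W] [Module R W]
    {p q : h.obj M →ₗ[R] W}
    (hpq : ∀ m, p.rTensor X.carrier (eta adj M m) = q.rTensor X.carrier (eta adj M m)) :
    p = q := by
  have h1 : (adj.homEquiv M (ModuleCat.of R W)) (ModuleCat.ofHom p) =
      (adj.homEquiv M (ModuleCat.of R W)) (ModuleCat.ofHom q) := by
    rw [Adjunction.homEquiv_unit, Adjunction.homEquiv_unit]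
    exact Subtype.ext (LinearMap.ext hpq)
  have h2 := (adj.homEquiv M (ModuleCat.of R W)).injective h1
  exact congrArg ModuleCat.Hom.hom h2

theorem coactMap_mem (M : RComod R C) :
    (TensorProduct.assoc R (h.obj M) (h.obj X) X.carrier).symm.toLinearMap ∘ₗ
      (eta adj X).lTensor (h.obj M) ∘ₗ eta adj M ∈
    RComod.colinear M (RComod.tensorObj (h.obj M ⊗[R] h.obj X) X) :=
  RComod.comp_mem (N := RComod.tensorObj (h.obj M) (RComod.tensorObj (h.obj X) X))
    (RComod.assoc_symm_mem (h.obj M) (h.obj X) X)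
    (RComod.comp_mem (N := RComod.tensorObj (h.obj M) X)
      (RComod.lTensor_mem (h.obj M) (eta_mem adj X)) (eta_mem adj M))

/-- The map `ρ_h : h(M) → h(M) ⊗ h(X)` determined by `(ρ_h ⊗ id) η_M = (id ⊗ η_X) η_M`. For
`M = X` it is the comultiplication of the coendomorphism coalgebra. -/
def coactMap (M : RComod R C) : h.obj M →ₗ[R] h.obj M ⊗[R] h.obj X :=
  desc adj _ (coactMap_mem adj M)

theorem coactMap_eta (M : RComod R C) (m : M.carrier) :
    (coactMap adj M).rTensor X.carrier (eta adj M m) =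
      (TensorProduct.assoc R (h.obj M) (h.obj X) X.carrier).symm
        ((eta adj X).lTensor (h.obj M) (eta adj M m)) :=
  desc_apply adj _ (coactMap_mem adj M) m

theorem counitMap_mem : TensorProduct.mk R R X.carrier 1 ∈
    RComod.colinear X (RComod.tensorObj R X) := by
  rw [RComod.mem_colinear]
  refine LinearMap.ext fun x => ?_
  simp only [RComod.tensorObj, LinearMap.comp_apply, LinearMap.lTensor_tmul,
    LinearEquiv.coe_coe, TensorProduct.mk_apply]
  induction X.rcoact x with
  | zero => simp
  | add a b ha hb => simp only [tmul_add, map_add, ha, hb]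
  | tmul a c => simp

/-- The map `h(X) → R` that corresponds to the canonical map `X ≅ R ⊗ X`. -/
def counitMap : h.obj X →ₗ[R] R :=
  desc adj (TensorProduct.mk R R X.carrier 1) counitMap_mem

theorem counitMap_eta (x : X.carrier) :
    (counitMap adj).rTensor X.carrier (eta adj X x) = 1 ⊗ₜ x :=
  desc_apply adj _ counitMap_mem x

theorem coactMap_coassoc (M : RComod R C) :
    TensorProduct.assoc R (h.obj M) (h.obj X) (h.obj X) ∘ₗ
      (coactMap adj M).rTensor (h.obj X) ∘ₗ coactMap adj M =
    (coactMap adj X).lTensor (h.obj M) ∘ₗ coactMap adj M := by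
  refine cohom_ext adj fun m => ?_
  simp only [LinearMap.rTensor_comp, LinearMap.comp_apply, coactMap_eta]
  have h1 : ∀ s : h.obj M ⊗[R] X.carrier,
      ((coactMap adj M).rTensor (h.obj X)).rTensor X.carrier
        ((TensorProduct.assoc R (h.obj M) (h.obj X) X.carrier).symm
          ((eta adj X).lTensor (h.obj M) s)) =
      (TensorProduct.assoc R (h.obj M ⊗[R] h.obj X) (h.obj X) X.carrier).symm
        ((eta adj X).lTensor (h.obj M ⊗[R] h.obj X) ((coactMap adj M).rTensor X.carrier s)) := by
    intro s
    induction s with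
    | zero => simp
    | add a b ha hb => simp only [map_add, ha, hb]
    | tmul a x =>
      simp only [LinearMap.lTensor_tmul, LinearMap.rTensor_tmul]
      induction eta adj X x with
      | zero => simp
      | add a b ha hb => simp only [tmul_add, map_add, ha, hb]
      | tmul e y => simp
  have h2 : ∀ s : h.obj M ⊗[R] X.carrier,
      ((coactMap adj X).lTensor (h.obj M)).rTensor X.carrier
        ((TensorProduct.assoc R (h.obj M) (h.obj X) X.carrier).symm
          ((eta adj X).lTensor (h.obj M) s)) =
      (TensorProduct.assoc R (h.obj M) (h.obj X ⊗[R] h.obj X) X.carrier).symm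
        (((coactMap adj X).rTensor X.carrier ∘ₗ eta adj X).lTensor (h.obj M) s) := by
    intro s
    induction s with
    | zero => simp
    | add a b ha hb => simp only [map_add, ha, hb]
    | tmul a x =>
      simp only [LinearMap.lTensor_tmul, LinearMap.comp_apply]
      induction eta adj X x with
      | zero => simp
      | add a b ha hb => simp only [tmul_add, map_add, ha, hb]
      | tmul e y => simp
  have h3 : (coactMap adj X).rTensor X.carrier ∘ₗ eta adj X =
      (TensorProduct.assoc R (h.obj X) (h.obj X) X.carrier).symm.toLinearMap ∘ₗ
        (eta adj X).lTensor (h.obj X) ∘ₗ eta adj X :=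
    LinearMap.ext (coactMap_eta adj X)
  rw [h1, h2, h3, coactMap_eta]
  induction eta adj M m with
  | zero => simp
  | add a b ha hb => simp only [map_add, ha, hb]
  | tmul a x =>
    simp only [LinearMap.lTensor_tmul, LinearMap.comp_apply, LinearEquiv.coe_coe]
    induction eta adj X x with
    | zero => simp
    | add a b ha hb => simp only [tmul_add, map_add, ha, hb]
    | tmul e y =>
      simp only [LinearMap.lTensor_tmul, assoc_symm_tmul]
      induction eta adj X y with
      | zero => simp
      | add a b ha hb => simp only [tmul_add, map_add, ha, hb]
      | tmul e' z => simp

theorem coactMap_counit (M : RComod R C) :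
    (counitMap adj).lTensor (h.obj M) ∘ₗ coactMap adj M =
      (TensorProduct.mk R (h.obj M) R).flip 1 := by
  refine cohom_ext adj fun m => ?_
  simp only [LinearMap.rTensor_comp, LinearMap.comp_apply, coactMap_eta]
  induction eta adj M m with
  | zero => simp
  | add a b ha hb => simp only [map_add, ha, hb]
  | tmul a x =>
    have h1 : ∀ t : h.obj X ⊗[R] X.carrier,
        ((counitMap adj).lTensor (h.obj M)).rTensor X.carrier
          ((TensorProduct.assoc R (h.obj M) (h.obj X) X.carrier).symm (a ⊗ₜ t)) =
        (TensorProduct.assoc R (h.obj M) R X.carrier).symm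
          (a ⊗ₜ (counitMap adj).rTensor X.carrier t) := by
      intro t
      induction t with
      | zero => simp
      | add a b ha hb => simp only [tmul_add, map_add, ha, hb]
      | tmul e y => simp
    rw [LinearMap.lTensor_tmul, h1, counitMap_eta]
    simp

theorem counit_coactMap :
    (counitMap adj).rTensor (h.obj X) ∘ₗ coactMap adj X = TensorProduct.mk R R (h.obj X) 1 := by
  refine cohom_ext adj fun m => ?_
  simp only [LinearMap.rTensor_comp, LinearMap.comp_apply, coactMap_eta]
  have h1 : ∀ s : h.obj X ⊗[R] X.carrier,
      ((counitMap adj).rTensor (h.obj X)).rTensor X.carrier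
        ((TensorProduct.assoc R (h.obj X) (h.obj X) X.carrier).symm
          ((eta adj X).lTensor (h.obj X) s)) =
      (TensorProduct.assoc R R (h.obj X) X.carrier).symm
        ((eta adj X).lTensor R ((counitMap adj).rTensor X.carrier s)) := by
    intro s
    induction s with
    | zero => simp
    | add a b ha hb => simp only [map_add, ha, hb]
    | tmul a x =>
      simp only [LinearMap.lTensor_tmul, LinearMap.rTensor_tmul]
      induction eta adj X x with
      | zero => simp
      | add a b ha hb => simp only [tmul_add, map_add, ha, hb]
      | tmul e y => simp
  rw [h1, counitMap_eta, LinearMap.lTensor_tmul]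
  induction eta adj X m with
  | zero => simp
  | add a b ha hb => simp only [tmul_add, map_add, ha, hb]
  | tmul e y => simp

/-- The `R`-module `e_C(X) = h_C(X,X)` underlying the coendomorphism coalgebra. -/
@[nolint unusedArguments]
def Coend (_adj : h ⊣ tensorFunctor X) : Type u := h.obj X

instance : AddCommGroup (Coend adj) := inferInstanceAs (AddCommGroup (h.obj X))

instance : Module R (Coend adj) := inferInstanceAs (Module R (h.obj X))

/-- The coendomorphism coalgebra `e_C(X)`: the comultiplication corresponds to
`(id ⊗ η_X) η_X`, the counit to `X ≅ R ⊗ X`. -/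
instance : Coalgebra R (Coend adj) where
  comul := coactMap adj X
  counit := counitMap adj
  coassoc := coactMap_coassoc adj X
  rTensor_counit_comp_comul := counit_coactMap adj
  lTensor_counit_comp_comul := coactMap_counit adj X

/-- `X` as an `e_C(X)`-`C`-bicomodule, with left coaction `η_X`. -/
def coendBicomod : Bicomod R (Coend adj) C where
  toLComod :=
    { carrier := X.carrier
      lcoact := eta adj X
      lcoassoc := by
        refine LinearMap.ext fun x => ?_
        have h1 := congrArg (TensorProduct.assoc R (h.obj X) (h.obj X) X.carrier)
          (coactMap_eta adj X x)
        rw [LinearEquiv.apply_symm_apply] at h1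
        exact h1
      lcounit := LinearMap.ext (counitMap_eta adj) }
  rcoact := X.rcoact
  rcoassoc := X.rcoassoc
  rcounit := X.rcounit
  coact_comm := by
    refine LinearMap.ext fun x => ?_
    have h1 := LinearMap.congr_fun (RComod.mem_colinear.1 (eta_mem adj X)) x
    have h2 := congrArg (TensorProduct.assoc R (h.obj X) X.carrier C) h1
    simp only [RComod.tensorObj, LinearMap.comp_apply, LinearEquiv.coe_coe,
      LinearEquiv.apply_symm_apply] at h2
    exact h2.symm

section Bicomodule

variable {D : Type u} [AddCommGroup D] [Module R D] [Coalgebra R D]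

theorem Bicomod.lcoact_mem (M : Bicomod R D C) :
    M.lcoact ∈ RComod.colinear M.toRComod (RComod.tensorObj D M.toRComod) := by
  rw [RComod.mem_colinear]
  refine LinearMap.ext fun x => ?_
  have h1 := LinearMap.congr_fun M.coact_comm x
  simp only [RComod.tensorObj, LinearMap.comp_apply, LinearEquiv.coe_coe] at h1 ⊢
  rw [← h1, LinearEquiv.symm_apply_apply]

theorem lcoactMap_mem (M : Bicomod R D C) :
    (TensorProduct.assoc R D (h.obj M.toRComod) X.carrier).symm.toLinearMap ∘ₗ
      (eta adj M.toRComod).lTensor D ∘ₗ M.lcoact ∈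
    RComod.colinear M.toRComod (RComod.tensorObj (D ⊗[R] h.obj M.toRComod) X) :=
  RComod.comp_mem (N := RComod.tensorObj D (RComod.tensorObj (h.obj M.toRComod) X))
    (RComod.assoc_symm_mem D (h.obj M.toRComod) X)
    (RComod.comp_mem (N := RComod.tensorObj D M.toRComod)
      (RComod.lTensor_mem D (eta_mem adj M.toRComod)) M.lcoact_mem)

/-- For a `D`-`C`-bicomodule `M`, the left coaction `h(M) → D ⊗ h(M)`: the map `h(ρ_M)` followed
by the canonical isomorphism `λ : h(D ⊗ M) ≅ D ⊗ h(M)`, that is, the unique linear map `ρ` with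
`(ρ ⊗ id) η_M = (id ⊗ η_M) ρ_M`. -/
def lcoactMap (M : Bicomod R D C) : h.obj M.toRComod →ₗ[R] D ⊗[R] h.obj M.toRComod :=
  desc adj _ (lcoactMap_mem adj M)

theorem lcoactMap_eta (M : Bicomod R D C) (m : M.carrier) :
    (lcoactMap adj M).rTensor X.carrier (eta adj M.toRComod m) =
      (TensorProduct.assoc R D (h.obj M.toRComod) X.carrier).symm
        ((eta adj M.toRComod).lTensor D (M.lcoact m)) :=
  desc_apply adj _ (lcoactMap_mem adj M) m

theorem lcoactMap_coassoc (M : Bicomod R D C) :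
    TensorProduct.assoc R D D (h.obj M.toRComod) ∘ₗ
      (Coalgebra.comul (R := R) (A := D)).rTensor (h.obj M.toRComod) ∘ₗ lcoactMap adj M =
    (lcoactMap adj M).lTensor D ∘ₗ lcoactMap adj M := by
  refine cohom_ext adj fun m => ?_
  simp only [LinearMap.rTensor_comp, LinearMap.comp_apply]
  erw [lcoactMap_eta adj M m]
  have h1 : ∀ s : D ⊗[R] M.carrier,
      ((TensorProduct.assoc R D D (h.obj M.toRComod)).toLinearMap).rTensor X.carrier
        (((Coalgebra.comul (R := R) (A := D)).rTensor (h.obj M.toRComod)).rTensor X.carrier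
          ((TensorProduct.assoc R D (h.obj M.toRComod) X.carrier).symm
            ((eta adj M.toRComod).lTensor D s))) =
      (TensorProduct.assoc R D (D ⊗[R] h.obj M.toRComod) X.carrier).symm
        (((TensorProduct.assoc R D (h.obj M.toRComod) X.carrier).symm.toLinearMap ∘ₗ
          (eta adj M.toRComod).lTensor D).lTensor D
          (TensorProduct.assoc R D D M.carrier
            ((Coalgebra.comul (R := R) (A := D)).rTensor M.carrier s))) := by
    intro s
    induction s with
    | zero => simp
    | add a b ha hb => simp only [map_add, ha, hb]
    | tmul a x =>
      simp only [LinearMap.lTensor_tmul, LinearMap.rTensor_tmul]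
      have h0 : ∀ t : h.obj M.toRComod ⊗[R] X.carrier,
          ((Coalgebra.comul (R := R) (A := D)).rTensor (h.obj M.toRComod)).rTensor X.carrier
            ((TensorProduct.assoc R D (h.obj M.toRComod) X.carrier).symm (a ⊗ₜ t)) =
          (TensorProduct.assoc R (D ⊗[R] D) (h.obj M.toRComod) X.carrier).symm
            (Coalgebra.comul (R := R) a ⊗ₜ t) := by
        intro t
        induction t with
        | zero => simp
        | add a b ha hb => simp only [tmul_add, map_add, ha, hb]
        | tmul e y => simp
      rw [h0]
      induction Coalgebra.comul (R := R) a with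
      | zero => simp
      | add a b ha hb => simp only [add_tmul, map_add, ha, hb]
      | tmul d d' =>
        simp only [LinearMap.lTensor_tmul, LinearMap.comp_apply, assoc_tmul, LinearEquiv.coe_coe]
        induction eta adj M.toRComod x with
        | zero => simp
        | add a b ha hb => simp only [tmul_add, map_add, ha, hb]
        | tmul e y => simp
  have h2 : ∀ s : D ⊗[R] M.carrier,
      ((lcoactMap adj M).lTensor D).rTensor X.carrier
        ((TensorProduct.assoc R D (h.obj M.toRComod) X.carrier).symm
          ((eta adj M.toRComod).lTensor D s)) =
      (TensorProduct.assoc R D (D ⊗[R] h.obj M.toRComod) X.carrier).symm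
        (((TensorProduct.assoc R D (h.obj M.toRComod) X.carrier).symm.toLinearMap ∘ₗ
          (eta adj M.toRComod).lTensor D).lTensor D (M.lcoact.lTensor D s)) := by
    intro s
    induction s with
    | zero => simp
    | add a b ha hb => simp only [map_add, ha, hb]
    | tmul a x =>
      simp only [LinearMap.lTensor_tmul, LinearMap.comp_apply, LinearEquiv.coe_coe]
      rw [← lcoactMap_eta]
      induction eta adj M.toRComod x with
      | zero => simp
      | add a b ha hb => simp only [tmul_add, map_add, ha, hb]
      | tmul e y => simp
  have h3 := LinearMap.congr_fun M.lcoassoc m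
  simp only [LinearMap.comp_apply, LinearEquiv.coe_coe] at h3
  rw [h1, h2, h3]

theorem lcoactMap_counit (M : Bicomod R D C) :
    (Coalgebra.counit (R := R) (A := D)).rTensor (h.obj M.toRComod) ∘ₗ lcoactMap adj M =
      TensorProduct.mk R R (h.obj M.toRComod) 1 := by
  refine cohom_ext adj fun m => ?_
  simp only [LinearMap.rTensor_comp, LinearMap.comp_apply]
  erw [lcoactMap_eta adj M m]
  have h1 : ∀ s : D ⊗[R] M.carrier,
      ((Coalgebra.counit (R := R) (A := D)).rTensor (h.obj M.toRComod)).rTensor X.carrier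
        ((TensorProduct.assoc R D (h.obj M.toRComod) X.carrier).symm
          ((eta adj M.toRComod).lTensor D s)) =
      (TensorProduct.assoc R R (h.obj M.toRComod) X.carrier).symm
        ((eta adj M.toRComod).lTensor R
          ((Coalgebra.counit (R := R) (A := D)).rTensor M.carrier s)) := by
    intro s
    induction s with
    | zero => simp
    | add a b ha hb => simp only [map_add, ha, hb]
    | tmul a x =>
      simp only [LinearMap.lTensor_tmul, LinearMap.rTensor_tmul]
      induction eta adj M.toRComod x with
      | zero => simp
      | add a b ha hb => simp only [tmul_add, map_add, ha, hb]
      | tmul e y => simp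
  have h3 := LinearMap.congr_fun M.lcounit m
  simp only [LinearMap.comp_apply, TensorProduct.mk_apply] at h3
  rw [h1, h3, LinearMap.lTensor_tmul]
  induction eta adj M.toRComod m with
  | zero => simp
  | add a b ha hb => simp only [tmul_add, map_add, ha, hb]
  | tmul e y => simp

theorem lcoactMap_coactMap (M : Bicomod R D C) :
    TensorProduct.assoc R D (h.obj M.toRComod) (h.obj X) ∘ₗ
      (lcoactMap adj M).rTensor (h.obj X) ∘ₗ coactMap adj M.toRComod =
    (coactMap adj M.toRComod).lTensor D ∘ₗ lcoactMap adj M := by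
  refine cohom_ext adj fun m => ?_
  simp only [LinearMap.rTensor_comp, LinearMap.comp_apply]
  erw [lcoactMap_eta adj M m, coactMap_eta adj M.toRComod m]
  have h1 : ∀ s : h.obj M.toRComod ⊗[R] X.carrier,
      ((lcoactMap adj M).rTensor (h.obj X)).rTensor X.carrier
        ((TensorProduct.assoc R (h.obj M.toRComod) (h.obj X) X.carrier).symm
          ((eta adj X).lTensor (h.obj M.toRComod) s)) =
      (TensorProduct.assoc R (D ⊗[R] h.obj M.toRComod) (h.obj X) X.carrier).symm
        ((eta adj X).lTensor (D ⊗[R] h.obj M.toRComod)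
          ((lcoactMap adj M).rTensor X.carrier s)) := by
    intro s
    induction s with
    | zero => simp
    | add a b ha hb => simp only [map_add, ha, hb]
    | tmul a x =>
      simp only [LinearMap.lTensor_tmul, LinearMap.rTensor_tmul]
      induction eta adj X x with
      | zero => simp
      | add a b ha hb => simp only [tmul_add, map_add, ha, hb]
      | tmul e y => simp
  rw [h1, lcoactMap_eta]
  induction M.lcoact m with
  | zero => simp
  | add a b ha hb => simp only [map_add, ha, hb]
  | tmul d x =>
    simp only [LinearMap.lTensor_tmul]
    have h2 : ∀ s : h.obj M.toRComod ⊗[R] X.carrier,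
        ((coactMap adj M.toRComod).lTensor D).rTensor X.carrier
          ((TensorProduct.assoc R D (h.obj M.toRComod) X.carrier).symm (d ⊗ₜ s)) =
        (TensorProduct.assoc R D (h.obj M.toRComod ⊗[R] h.obj X) X.carrier).symm
          (d ⊗ₜ (coactMap adj M.toRComod).rTensor X.carrier s) := by
      intro s
      induction s with
      | zero => simp
      | add a b ha hb => simp only [tmul_add, map_add, ha, hb]
      | tmul e y => simp
    rw [h2, coactMap_eta]
    induction eta adj M.toRComod x with
    | zero => simp
    | add a b ha hb => simp only [tmul_add, map_add, ha, hb]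
    | tmul e y =>
      simp only [LinearMap.lTensor_tmul, assoc_symm_tmul]
      induction eta adj X y with
      | zero => simp
      | add a b ha hb => simp only [tmul_add, map_add, ha, hb]
      | tmul e' z => simp

/-- For a `D`-`C`-bicomodule `M`, the `D`-`e_C(X)`-bicomodule `h(M)`. -/
def cohomBicomod (M : Bicomod R D C) : Bicomod R D (Coend adj) where
  toLComod :=
    { carrier := h.obj M.toRComod
      lcoact := lcoactMap adj M
      lcoassoc := lcoactMap_coassoc adj M
      lcounit := lcoactMap_counit adj M }
  rcoact := coactMap adj M.toRComod
  rcoassoc := coactMap_coassoc adj M.toRComod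
  rcounit := coactMap_counit adj M.toRComod
  coact_comm := lcoactMap_coactMap adj M

end Bicomodule

/-- The right `e_C(X)`-comodule `h(M)`, for a right `C`-comodule `M`. -/
def cohomRComod (M : RComod R C) : RComod R (Coend adj) where
  carrier := h.obj M
  rcoact := coactMap adj M
  rcoassoc := coactMap_coassoc adj M
  rcounit := coactMap_counit adj M

variable (C) in
/-- The `C`-`e_C(X)`-bicomodule `h_C(X,C)`. -/
abbrev cohomSelf : Bicomod R C (Coend adj) := cohomBicomod adj (Bicomod.self R C)

theorem deltaMap_mem (M : RComod R C) :
    (TensorProduct.assoc R M.carrier (h.obj (Bicomod.self R C).toRComod) X.carrier).symm.toLinearMap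
      ∘ₗ (eta adj (Bicomod.self R C).toRComod).lTensor M.carrier ∘ₗ M.rcoact ∈
    RComod.colinear M
      (RComod.tensorObj (M.carrier ⊗[R] h.obj (Bicomod.self R C).toRComod) X) :=
  RComod.comp_mem
    (N := RComod.tensorObj M.carrier (RComod.tensorObj (h.obj (Bicomod.self R C).toRComod) X))
    (RComod.assoc_symm_mem M.carrier (h.obj (Bicomod.self R C).toRComod) X)
    (RComod.comp_mem (N := RComod.tensorObj M.carrier (Bicomod.self R C).toRComod)
      (RComod.lTensor_mem M.carrier (eta_mem adj (Bicomod.self R C).toRComod)) M.rcoact_mem)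

/-- The unique linear map `δ : h(M) → M ⊗ h(C)` with `(δ ⊗ id) η_M = (id ⊗ η_C) ρ_M`. -/
def deltaMap (M : RComod R C) :
    h.obj M →ₗ[R] M.carrier ⊗[R] h.obj (Bicomod.self R C).toRComod :=
  desc adj _ (deltaMap_mem adj M)

theorem deltaMap_eta (M : RComod R C) (m : M.carrier) :
    (deltaMap adj M).rTensor X.carrier (eta adj M m) =
      (TensorProduct.assoc R M.carrier (h.obj (Bicomod.self R C).toRComod) X.carrier).symm
        ((eta adj (Bicomod.self R C).toRComod).lTensor M.carrier (M.rcoact m)) :=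
  desc_apply adj _ (deltaMap_mem adj M) m

theorem deltaMap_cotensor_aux {V K Y : Type u} [AddCommGroup V] [Module R V] [AddCommGroup K]
    [Module R K] [AddCommGroup Y] [Module R Y] (p : V →ₗ[R] V ⊗[R] C) (q : C →ₗ[R] K ⊗[R] Y)
    (l : K →ₗ[R] C ⊗[R] K)
    (hl : ∀ c, l.rTensor Y (q c) = (TensorProduct.assoc R C K Y).symm
      (q.lTensor C (Coalgebra.comul (R := R) c)))
    (v : V) (hv : TensorProduct.assoc R V C C (p.rTensor C (p v)) =
      (Coalgebra.comul (R := R) (A := C)).lTensor V (p v)) :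
    (TensorProduct.assoc R V C K).toLinearMap.rTensor Y
      ((p.rTensor K).rTensor Y ((TensorProduct.assoc R V K Y).symm (q.lTensor V (p v)))) =
    (l.lTensor V).rTensor Y ((TensorProduct.assoc R V K Y).symm (q.lTensor V (p v))) := by
  have h1 : ∀ s : V ⊗[R] C,
      (TensorProduct.assoc R V C K).toLinearMap.rTensor Y
        ((p.rTensor K).rTensor Y ((TensorProduct.assoc R V K Y).symm (q.lTensor V s))) =
      (TensorProduct.assoc R V (C ⊗[R] K) Y).symm
        (((TensorProduct.assoc R C K Y).symm.toLinearMap ∘ₗ q.lTensor C).lTensor V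
          (TensorProduct.assoc R V C C (p.rTensor C s))) := by
    intro s
    induction s with
    | zero => simp
    | add a b ha hb => simp only [map_add, ha, hb]
    | tmul a c =>
      have h0 : ∀ t : K ⊗[R] Y,
          (p.rTensor K).rTensor Y ((TensorProduct.assoc R V K Y).symm (a ⊗ₜ t)) =
          (TensorProduct.assoc R (V ⊗[R] C) K Y).symm (p a ⊗ₜ t) := by
        intro t
        induction t with
        | zero => simp
        | add a b ha hb => simp only [tmul_add, map_add, ha, hb]
        | tmul e y => simp
      rw [LinearMap.lTensor_tmul, LinearMap.rTensor_tmul, h0]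
      induction p a with
      | zero => simp
      | add a b ha hb => simp only [add_tmul, map_add, ha, hb]
      | tmul d d' =>
        simp only [LinearMap.lTensor_tmul, LinearMap.comp_apply, assoc_tmul, LinearEquiv.coe_coe]
        induction q c with
        | zero => simp
        | add a b ha hb => simp only [tmul_add, map_add, ha, hb]
        | tmul e y => simp
  have h2 : ∀ s : V ⊗[R] C,
      (l.lTensor V).rTensor Y ((TensorProduct.assoc R V K Y).symm (q.lTensor V s)) =
      (TensorProduct.assoc R V (C ⊗[R] K) Y).symm
        (((TensorProduct.assoc R C K Y).symm.toLinearMap ∘ₗ q.lTensor C).lTensor V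
          ((Coalgebra.comul (R := R) (A := C)).lTensor V s)) := by
    intro s
    induction s with
    | zero => simp
    | add a b ha hb => simp only [map_add, ha, hb]
    | tmul a c =>
      simp only [LinearMap.lTensor_tmul, LinearMap.comp_apply, LinearEquiv.coe_coe]
      rw [← hl]
      induction q c with
      | zero => simp
      | add a b ha hb => simp only [tmul_add, map_add, ha, hb]
      | tmul e y => simp
  rw [h1, h2, hv]

theorem deltaMap_cotensor (M : RComod R C) (t : h.obj M) :
    deltaMap adj M t ∈ cotensor M (cohomSelf C adj).toLComod := by
  refine mem_cotensor.2 ?_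
  suffices H : (TensorProduct.assoc R M.carrier C (h.obj (Bicomod.self R C).toRComod)).toLinearMap ∘ₗ
      M.rcoact.rTensor (h.obj (Bicomod.self R C).toRComod) ∘ₗ deltaMap adj M =
      (lcoactMap adj (Bicomod.self R C)).lTensor M.carrier ∘ₗ deltaMap adj M from
    LinearMap.congr_fun H t
  refine cohom_ext adj fun m => ?_
  simp only [LinearMap.rTensor_comp, LinearMap.comp_apply, deltaMap_eta]
  exact deltaMap_cotensor_aux M.rcoact (eta adj (Bicomod.self R C).toRComod)
    (lcoactMap adj (Bicomod.self R C)) (lcoactMap_eta adj (Bicomod.self R C)) m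
    (LinearMap.congr_fun M.rcoassoc m)

/-- The canonical map `δ_M : h(M) → M □_C h(C)`. -/
def delta (M : RComod R C) : h.obj M →ₗ[R] cotensor M (cohomSelf C adj).toLComod :=
  (deltaMap adj M).codRestrict _ (deltaMap_cotensor adj M)

/-- The unit `η_M` with values in `h(M) □_{e_C(X)} X`. -/
def etaCotensor (M : RComod R C) :
    M.carrier →ₗ[R] cotensor (cohomRComod adj M) (coendBicomod adj).toLComod :=
  (eta adj M).codRestrict _ fun m => by
    refine mem_cotensor.2 ?_
    have h1 := congrArg (TensorProduct.assoc R (h.obj M) (h.obj X) X.carrier)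
      (coactMap_eta adj M m)
    rw [LinearEquiv.apply_symm_apply] at h1
    exact h1

end Cohom

/-! ## Morita-Takeuchi contexts -/

section Context

variable {R D C : Type u} [CommRing R] [AddCommGroup D] [Module R D] [Coalgebra R D]
  [AddCommGroup C] [Module R C] [Coalgebra R C]

/-- A submodule `P` of `V` is pure if `P ⊗ W → V ⊗ W` is injective for every module `W`. -/
def IsPure {V : Type u} [AddCommGroup V] [Module R V] (P : Submodule R V) : Prop :=
  ∀ (W : Type u) [AddCommGroup W] [Module R W], Function.Injective (P.subtype.rTensor W)

/-- A linear map `f : D → M □_C N`, for bicomodules `M` (over `D`, `C`) and `N` (over `C`, `D`), is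
a morphism of `D`-`D`-bicomodules. Here `M □_C N` is a subbicomodule of `M ⊗ N`, on which `D`
coacts from the left through `M` and from the right through `N`, so that colinearity is tested
after the inclusion into `M ⊗ N`. -/
structure IsBicolinear (M : Bicomod R D C) (N : Bicomod R C D)
    (f : D →ₗ[R] cotensor M.toRComod N.toLComod) : Prop where
  left : (cotensor M.toRComod N.toLComod).subtype ∘ₗ f ∈
    LComod.colinear (Bicomod.self R D).toLComod (LComod.tensorObj M.toLComod N.carrier)
  right : (cotensor M.toRComod N.toLComod).subtype ∘ₗ f ∈
    RComod.colinear (Bicomod.self R D).toRComod (RComod.tensorObj M.carrier N.toRComod)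

/-- `(D, C, M, N, f, g)` is a Morita-Takeuchi context. The two diagrams are written in the modules
`M ⊗ N ⊗ M` and `N ⊗ M ⊗ N`, which by flatness and purity contain the threefold cotensor
products; the isomorphisms `M ≅ M □_C C`, `M ≅ D □_D M` are the coactions. -/
structure IsContext (M : Bicomod R D C) (N : Bicomod R C D)
    (f : D →ₗ[R] cotensor M.toRComod N.toLComod)
    (g : C →ₗ[R] cotensor N.toRComod M.toLComod) : Prop where
  flat_left : Module.Flat R D
  flat_right : Module.Flat R C
  bicolinear_f : IsBicolinear M N f
  bicolinear_g : IsBicolinear N M g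
  flat_M : Module.Flat R M.carrier
  flat_N : Module.Flat R N.carrier
  pure_MN : IsPure (cotensor M.toRComod N.toLComod)
  pure_NM : IsPure (cotensor N.toRComod M.toLComod)
  diagram_M :
    ((cotensor N.toRComod M.toLComod).subtype ∘ₗ g).lTensor M.carrier ∘ₗ M.rcoact =
    TensorProduct.assoc R M.carrier N.carrier M.carrier ∘ₗ
      ((cotensor M.toRComod N.toLComod).subtype ∘ₗ f).rTensor M.carrier ∘ₗ M.lcoact
  diagram_N :
    ((cotensor M.toRComod N.toLComod).subtype ∘ₗ f).lTensor N.carrier ∘ₗ N.rcoact =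
    TensorProduct.assoc R N.carrier M.carrier N.carrier ∘ₗ
      ((cotensor N.toRComod M.toLComod).subtype ∘ₗ g).rTensor N.carrier ∘ₗ N.lcoact

/-- `(D, C, M, N, f, g)` is a strict Morita-Takeuchi context: `f` and `g` are bijective. -/
structure IsStrictContext (M : Bicomod R D C) (N : Bicomod R C D)
    (f : D →ₗ[R] cotensor M.toRComod N.toLComod)
    (g : C →ₗ[R] cotensor N.toRComod M.toLComod) : Prop extends IsContext M N f g where
  bijective_f : Function.Bijective f
  bijective_g : Function.Bijective g

end Context

end MoritaTakeuchi

end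

/-! Write `E` for `e_C(X)`. The engine is that `h` is exact and commutes with tensoring by modules.
As a left adjoint it is right exact (`cohomMap_ker_le`); since `- ⊗ X` preserves injectives, it also
preserves injective maps (`cohomMap_injective`), hence kernels (`cohomMap_ker`). Together with `h(W
⊗ M) ≅ W ⊗ h(M)` (`cohomTensor_bijective`) this yields `h(P □_D M) = P □_D h(M)`
(`cohomTensor_comp_cohomMap`), which is used twice.

With `D = C` and both `M` and `D` equal to `C`, the isomorphism `P ≅ P □_C C` becomes `h(P) ≅ P □_C
h(C)`, so every `δ_P` is bijective. With `D = E` and `M = X` it becomes `h(P □_E X) ≅ P □_E E ≅ P`,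
so every right `E`-comodule comes from a `C`-comodule.

Faithful coflatness makes the unit injective. The kernel `K` of `η_C ⊗ W` is a left `C`-comodule,
and `X □_C K = 0` because `(id ⊗ η_C) ρ_X = (δ_X ⊗ id) η_X` is universally injective; hence `K = 0`
(`eta_self_rTensor_injective`). Injectivity of every `η_M` follows. For surjectivity onto `h(M) □_E
X`, the functor `h` kills the cokernel map of `M → h(M) □_E X`, and a map killed by `h` is zero
because units are injective (`mem_range_eta`).

Flatness comes from exactness of `h`, purity from the universal injectivity of `δ_X` and `η_C`, and
the diagrams and bicolinearity from the equations that define the maps out of `h`. The same facts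
make `h`, with values in `E`-comodules, faithful, full and essentially surjective. -/

namespace MoritaTakeuchi

noncomputable section

/-! ### Interchange of tensored maps and naturality of the associator. -/

section Shuffle

variable {R : Type u} [CommRing R] {A A' B B' D D' : Type*} [AddCommGroup A] [Module R A]
  [AddCommGroup A'] [Module R A'] [AddCommGroup B] [Module R B] [AddCommGroup B'] [Module R B']
  [AddCommGroup D] [Module R D] [AddCommGroup D'] [Module R D']

theorem rTensor_lTensor_apply (f : A →ₗ[R] A') (g : B →ₗ[R] B') (t : A ⊗[R] B) :
    f.rTensor B' (g.lTensor A t) = g.lTensor A' (f.rTensor B t) := by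
  rw [← LinearMap.comp_apply, ← LinearMap.comp_apply, LinearMap.rTensor_comp_lTensor,
    LinearMap.lTensor_comp_rTensor]

theorem assoc_rTensor_rTensor (f : A →ₗ[R] A') (t : (A ⊗[R] B) ⊗[R] D) :
    TensorProduct.assoc R A' B D ((f.rTensor B).rTensor D t) =
      f.rTensor (B ⊗[R] D) (TensorProduct.assoc R A B D t) := by
  have h : (TensorProduct.assoc R A' B D).toLinearMap ∘ₗ (f.rTensor B).rTensor D =
      f.rTensor (B ⊗[R] D) ∘ₗ (TensorProduct.assoc R A B D).toLinearMap := by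
    ext; simp
  exact LinearMap.congr_fun h t

theorem assoc_lTensor_rTensor (f : B →ₗ[R] B') (t : (A ⊗[R] B) ⊗[R] D) :
    TensorProduct.assoc R A B' D ((f.lTensor A).rTensor D t) =
      (f.rTensor D).lTensor A (TensorProduct.assoc R A B D t) := by
  have h : (TensorProduct.assoc R A B' D).toLinearMap ∘ₗ (f.lTensor A).rTensor D =
      (f.rTensor D).lTensor A ∘ₗ (TensorProduct.assoc R A B D).toLinearMap := by
    ext; simp
  exact LinearMap.congr_fun h t

theorem assoc_lTensor (f : D →ₗ[R] D') (t : (A ⊗[R] B) ⊗[R] D) :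
    TensorProduct.assoc R A B D' (f.lTensor (A ⊗[R] B) t) =
      (f.lTensor B).lTensor A (TensorProduct.assoc R A B D t) := by
  have h : (TensorProduct.assoc R A B D').toLinearMap ∘ₗ f.lTensor (A ⊗[R] B) =
      (f.lTensor B).lTensor A ∘ₗ (TensorProduct.assoc R A B D).toLinearMap := by
    ext; simp
  exact LinearMap.congr_fun h t

theorem rTensor_rTensor_assoc_symm (f : A →ₗ[R] A') (t : A ⊗[R] (B ⊗[R] D)) :
    (f.rTensor B).rTensor D ((TensorProduct.assoc R A B D).symm t) =
      (TensorProduct.assoc R A' B D).symm (f.rTensor (B ⊗[R] D) t) := by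
  rw [LinearEquiv.eq_symm_apply, assoc_rTensor_rTensor, LinearEquiv.apply_symm_apply]

theorem lTensor_rTensor_assoc_symm (f : B →ₗ[R] B') (t : A ⊗[R] (B ⊗[R] D)) :
    (f.lTensor A).rTensor D ((TensorProduct.assoc R A B D).symm t) =
      (TensorProduct.assoc R A B' D).symm ((f.rTensor D).lTensor A t) := by
  rw [LinearEquiv.eq_symm_apply, assoc_lTensor_rTensor, LinearEquiv.apply_symm_apply]

theorem lTensor_assoc_symm (f : D →ₗ[R] D') (t : A ⊗[R] (B ⊗[R] D)) :
    f.lTensor (A ⊗[R] B) ((TensorProduct.assoc R A B D).symm t) =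
      (TensorProduct.assoc R A B D').symm ((f.lTensor B).lTensor A t) := by
  rw [LinearEquiv.eq_symm_apply, assoc_lTensor, LinearEquiv.apply_symm_apply]

end Shuffle

section LinearAlgebra

variable {R : Type u} [CommRing R]

/-- Used to restrict coactions to kernels and to lift maps through `P □ X → P ⊗ X` and through
injective units. -/
theorem exists_comp_eq_of_range_le {A B D : Type*} [AddCommGroup A] [Module R A] [AddCommGroup B]
    [Module R B] [AddCommGroup D] [Module R D] {j : A →ₗ[R] B} (hj : Function.Injective j)
    {f : D →ₗ[R] B} (hf : LinearMap.range f ≤ LinearMap.range j) :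
    ∃ g : D →ₗ[R] A, j ∘ₗ g = f := by
  refine ⟨(LinearEquiv.ofInjective j hj).symm.toLinearMap ∘ₗ
    f.codRestrict (LinearMap.range j) fun x => hf ⟨x, rfl⟩, LinearMap.ext fun x => ?_⟩
  have h := congrArg Subtype.val ((LinearEquiv.ofInjective j hj).apply_symm_apply
    (f.codRestrict (LinearMap.range j) (fun x => hf ⟨x, rfl⟩) x))
  exact h

end LinearAlgebra

/-! ### Comodules over a flat coalgebra: kernels, cokernels, cotensor products with cofree
comodules. -/

section Comodules

variable {R C : Type u} [CommRing R] [AddCommGroup C] [Module R C] [Coalgebra R C]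

theorem RComod.rcoact_counit (M : RComod R C) (m : M.carrier) :
    TensorProduct.rid R M.carrier
      ((Coalgebra.counit (R := R) (A := C)).lTensor M.carrier (M.rcoact m)) = m := by
  have h := LinearMap.congr_fun M.rcounit m
  simp only [LinearMap.comp_apply] at h
  rw [h]
  simp

theorem LComod.lcoact_counit (M : LComod R C) (m : M.carrier) :
    TensorProduct.lid R M.carrier
      ((Coalgebra.counit (R := R) (A := C)).rTensor M.carrier (M.lcoact m)) = m := by
  have h := LinearMap.congr_fun M.lcounit m
  simp only [LinearMap.comp_apply] at h
  rw [h]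
  simp

/-- The counit gives an `R`-linear retraction of any coaction, and a retraction survives tensoring
with `W`; neither `W` nor `M` has to be flat. -/
theorem RComod.rcoact_lTensor_injective (M : RComod R C) (W : Type u) [AddCommGroup W]
    [Module R W] : Function.Injective (M.rcoact.lTensor W) := by
  have h : ((TensorProduct.rid R M.carrier).toLinearMap ∘ₗ
      (Coalgebra.counit (R := R) (A := C)).lTensor M.carrier) ∘ₗ M.rcoact = LinearMap.id :=
    LinearMap.ext M.rcoact_counit
  refine Function.LeftInverse.injective (g := ((TensorProduct.rid R M.carrier).toLinearMap ∘ₗ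
      (Coalgebra.counit (R := R) (A := C)).lTensor M.carrier).lTensor W) fun x => ?_
  rw [← LinearMap.comp_apply, ← LinearMap.lTensor_comp, h, LinearMap.lTensor_id,
    LinearMap.id_apply]

theorem LComod.lcoact_rTensor_injective (M : LComod R C) (W : Type u) [AddCommGroup W]
    [Module R W] : Function.Injective (M.lcoact.rTensor W) := by
  have h : ((TensorProduct.lid R M.carrier).toLinearMap ∘ₗ
      (Coalgebra.counit (R := R) (A := C)).rTensor M.carrier) ∘ₗ M.lcoact = LinearMap.id :=
    LinearMap.ext M.lcoact_counit
  refine Function.LeftInverse.injective (g := ((TensorProduct.lid R M.carrier).toLinearMap ∘ₗ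
      (Coalgebra.counit (R := R) (A := C)).rTensor M.carrier).rTensor W) fun x => ?_
  rw [← LinearMap.comp_apply, ← LinearMap.rTensor_comp, h, LinearMap.rTensor_id,
    LinearMap.id_apply]

theorem RComod.rcoact_injective (M : RComod R C) : Function.Injective M.rcoact :=
  Function.LeftInverse.injective (g := fun t => TensorProduct.rid R M.carrier
      ((Coalgebra.counit (R := R) (A := C)).lTensor M.carrier t)) M.rcoact_counit

theorem RComod.coassoc_apply (M : RComod R C) (m : M.carrier) :
    TensorProduct.assoc R M.carrier C C (M.rcoact.rTensor C (M.rcoact m)) =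
      (Coalgebra.comul (R := R) (A := C)).lTensor M.carrier (M.rcoact m) :=
  LinearMap.congr_fun M.rcoassoc m

theorem LComod.coassoc_apply (M : LComod R C) (m : M.carrier) :
    TensorProduct.assoc R C C M.carrier
        ((Coalgebra.comul (R := R) (A := C)).rTensor M.carrier (M.lcoact m)) =
      M.lcoact.lTensor C (M.lcoact m) :=
  LinearMap.congr_fun M.lcoassoc m

theorem RComod.colinear_apply {M N : RComod R C} {f : M.carrier →ₗ[R] N.carrier}
    (hf : f ∈ RComod.colinear M N) (m : M.carrier) :
    N.rcoact (f m) = f.rTensor C (M.rcoact m) :=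
  LinearMap.congr_fun (RComod.mem_colinear.1 hf) m

theorem LComod.colinear_apply {M N : LComod R C} {f : M.carrier →ₗ[R] N.carrier}
    (hf : f ∈ LComod.colinear M N) (m : M.carrier) :
    N.lcoact (f m) = f.lTensor C (M.lcoact m) :=
  LinearMap.congr_fun (LComod.mem_colinear.1 hf) m

/-- The kernel of a colinear map between right comodules over a flat coalgebra. -/
theorem RComod.exists_kernel [Module.Flat R C] {N P : RComod R C}
    {g : N.carrier →ₗ[R] P.carrier} (hg : g ∈ RComod.colinear N P) :
    ∃ (K : RComod R C) (i : K.carrier →ₗ[R] N.carrier), i ∈ RComod.colinear K N ∧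
      Function.Injective i ∧ LinearMap.range i = LinearMap.ker g := by
  have hi : Function.Injective (LinearMap.ker g).subtype := Subtype.val_injective
  have hi1 : Function.Injective ((LinearMap.ker g).subtype.rTensor C) :=
    Module.Flat.rTensor_preserves_injective_linearMap _ hi
  have hi2 : Function.Injective ((LinearMap.ker g).subtype.rTensor (C ⊗[R] C)) :=
    Module.Flat.rTensor_preserves_injective_linearMap _ hi
  have hi3 : Function.Injective ((LinearMap.ker g).subtype.rTensor R) :=
    Module.Flat.rTensor_preserves_injective_linearMap _ hi
  -- Flatness of `C` identifies `ker g ⊗ C` with `ker (g ⊗ C)`, so the coaction of `N` restricts to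
  -- `ker g`; the axioms are then checked after injective inclusions.
  have hex : Function.Exact ((LinearMap.ker g).subtype.rTensor C) (g.rTensor C) :=
    Module.Flat.rTensor_exact C (LinearMap.exact_subtype_ker_map g)
  obtain ⟨r, hr⟩ := exists_comp_eq_of_range_le hi1
    (f := N.rcoact ∘ₗ (LinearMap.ker g).subtype) (by
      rintro _ ⟨x, rfl⟩
      refine (hex _).1 ?_
      rw [LinearMap.comp_apply, Submodule.subtype_apply, ← RComod.colinear_apply hg,
        LinearMap.mem_ker.1 x.2, map_zero])
  have hr' : ∀ x, (LinearMap.ker g).subtype.rTensor C (r x) = N.rcoact x.1 :=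
    fun x => LinearMap.congr_fun hr x
  refine ⟨{ carrier := LinearMap.ker g, rcoact := r, rcoassoc := ?_, rcounit := ?_ },
    (LinearMap.ker g).subtype, hr.symm, hi, by simp⟩
  · refine LinearMap.ext fun x => hi2 ?_
    simp only [LinearMap.comp_apply, LinearEquiv.coe_coe]
    rw [← assoc_rTensor_rTensor, ← LinearMap.comp_apply (LinearMap.rTensor C _),
      ← LinearMap.rTensor_comp, hr, LinearMap.rTensor_comp, LinearMap.comp_apply, hr',
      rTensor_lTensor_apply, hr', RComod.coassoc_apply]
  · refine LinearMap.ext fun x => hi3 ?_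
    rw [LinearMap.comp_apply, rTensor_lTensor_apply, hr']
    exact LinearMap.congr_fun N.rcounit x.1

/-- The kernel of a colinear map between left comodules over a flat coalgebra. -/
theorem LComod.exists_kernel [Module.Flat R C] {N P : LComod R C}
    {g : N.carrier →ₗ[R] P.carrier} (hg : g ∈ LComod.colinear N P) :
    ∃ (K : LComod R C) (i : K.carrier →ₗ[R] N.carrier), i ∈ LComod.colinear K N ∧
      Function.Injective i ∧ LinearMap.range i = LinearMap.ker g := by
  have hi : Function.Injective (LinearMap.ker g).subtype := Subtype.val_injective
  have hi1 : Function.Injective ((LinearMap.ker g).subtype.lTensor C) :=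
    Module.Flat.lTensor_preserves_injective_linearMap _ hi
  have hi2 : Function.Injective (((LinearMap.ker g).subtype.lTensor C).lTensor C) :=
    Module.Flat.lTensor_preserves_injective_linearMap _ hi1
  have hi3 : Function.Injective ((LinearMap.ker g).subtype.lTensor R) :=
    Module.Flat.lTensor_preserves_injective_linearMap _ hi
  have hex : Function.Exact ((LinearMap.ker g).subtype.lTensor C) (g.lTensor C) :=
    Module.Flat.lTensor_exact C (LinearMap.exact_subtype_ker_map g)
  obtain ⟨r, hr⟩ := exists_comp_eq_of_range_le hi1
    (f := N.lcoact ∘ₗ (LinearMap.ker g).subtype) (by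
      rintro _ ⟨x, rfl⟩
      refine (hex _).1 ?_
      rw [LinearMap.comp_apply, Submodule.subtype_apply, ← LComod.colinear_apply hg,
        LinearMap.mem_ker.1 x.2, map_zero])
  have hr' : ∀ x, (LinearMap.ker g).subtype.lTensor C (r x) = N.lcoact x.1 :=
    fun x => LinearMap.congr_fun hr x
  refine ⟨{ carrier := LinearMap.ker g, lcoact := r, lcoassoc := ?_, lcounit := ?_ },
    (LinearMap.ker g).subtype, hr.symm, hi, by simp⟩
  · refine LinearMap.ext fun x => hi2 ?_
    simp only [LinearMap.comp_apply, LinearEquiv.coe_coe]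
    rw [← assoc_lTensor, ← rTensor_lTensor_apply, hr', LComod.coassoc_apply,
      ← LinearMap.lTensor_comp_apply, hr, LinearMap.lTensor_comp_apply, hr']
  · refine LinearMap.ext fun x => hi3 ?_
    rw [LinearMap.comp_apply, ← rTensor_lTensor_apply, hr']
    exact LinearMap.congr_fun N.lcounit x.1

/-- The cokernel of a colinear map between right comodules. -/
theorem RComod.exists_cokernel {M N : RComod R C}
    {f : M.carrier →ₗ[R] N.carrier} (hf : f ∈ RComod.colinear M N) :
    ∃ (Q : RComod R C) (p : N.carrier →ₗ[R] Q.carrier), p ∈ RComod.colinear N Q ∧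
      Function.Surjective p ∧ LinearMap.ker p = LinearMap.range f := by
  let p := (LinearMap.range f).mkQ
  have hp : Function.Surjective p := Submodule.mkQ_surjective _
  have hpf : p ∘ₗ f = 0 := LinearMap.range_le_ker_iff.1 (by simp [p])
  -- The quotient needs no flatness: `(p ⊗ C) ρ_N` kills the image of `f`.
  let r : N.carrier ⧸ LinearMap.range f →ₗ[R] (N.carrier ⧸ LinearMap.range f) ⊗[R] C :=
    (LinearMap.range f).liftQ (p.rTensor C ∘ₗ N.rcoact) (by
      rintro _ ⟨x, rfl⟩
      rw [LinearMap.mem_ker, LinearMap.comp_apply, RComod.colinear_apply hf,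
        ← LinearMap.comp_apply, ← LinearMap.rTensor_comp, hpf, LinearMap.rTensor_zero,
        LinearMap.zero_apply])
  have hr : r ∘ₗ p = p.rTensor C ∘ₗ N.rcoact := Submodule.liftQ_mkQ _ _ _
  have hr' : ∀ x, r (p x) = p.rTensor C (N.rcoact x) := LinearMap.congr_fun hr
  refine ⟨{ carrier := (N.carrier ⧸ LinearMap.range f), rcoact := r, rcoassoc := ?_, rcounit := ?_ },
    p, hr, hp, Submodule.ker_mkQ _⟩
  · refine LinearMap.ext fun y => ?_
    obtain ⟨x, rfl⟩ := hp y
    simp only [LinearMap.comp_apply, LinearEquiv.coe_coe]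
    rw [hr', ← LinearMap.comp_apply (LinearMap.rTensor C r), ← LinearMap.rTensor_comp, hr,
      LinearMap.rTensor_comp, LinearMap.comp_apply, assoc_rTensor_rTensor,
      RComod.coassoc_apply, rTensor_lTensor_apply]
  · refine LinearMap.ext fun y => ?_
    obtain ⟨x, rfl⟩ := hp y
    rw [LinearMap.comp_apply, hr', ← rTensor_lTensor_apply, ← LinearMap.comp_apply _ N.rcoact,
      N.rcounit]
    simp

theorem LComod.rTensor_mem {M N : LComod R C} {f : M.carrier →ₗ[R] N.carrier}
    (hf : f ∈ LComod.colinear M N) (W : Type u) [AddCommGroup W] [Module R W] :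
    f.rTensor W ∈ LComod.colinear (LComod.tensorObj M W) (LComod.tensorObj N W) := by
  rw [LComod.mem_colinear]
  refine LinearMap.ext fun x => ?_
  simp only [LinearMap.comp_apply, LinearEquiv.coe_coe]
  rw [← assoc_lTensor_rTensor, ← LinearMap.comp_apply (LinearMap.rTensor W _),
    ← LinearMap.comp_apply (LinearMap.rTensor W _), ← LinearMap.rTensor_comp,
    ← LinearMap.rTensor_comp, LComod.mem_colinear.1 hf]

theorem LComod.lTensor_mem {W V : Type u} [AddCommGroup W] [Module R W] [AddCommGroup V]
    [Module R V] (f : W →ₗ[R] V) (M : LComod R C) :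
    f.lTensor M.carrier ∈ LComod.colinear (LComod.tensorObj M W) (LComod.tensorObj M V) := by
  rw [LComod.mem_colinear]
  refine LinearMap.ext fun x => ?_
  simp only [LinearMap.comp_apply, LinearEquiv.coe_coe]
  rw [← assoc_lTensor, rTensor_lTensor_apply]

/-- An element of `X □_C (C ⊗ W)` lies in the image of `ρ_X ⊗ W`. -/
theorem eq_of_mem_cotensor_tensorObj_self (X : RComod R C) (W : Type u) [AddCommGroup W]
    [Module R W] {t : X.carrier ⊗[R] (C ⊗[R] W)}
    (ht : t ∈ cotensor X (LComod.tensorObj (Bicomod.self R C).toLComod W)) :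
    t = TensorProduct.assoc R X.carrier C W (X.rcoact.rTensor W
      (((TensorProduct.lid R W).toLinearMap ∘ₗ
        (Coalgebra.counit (R := R) (A := C)).rTensor W).lTensor X.carrier t)) := by
  set e := (TensorProduct.lid R W).toLinearMap ∘ₗ
    (Coalgebra.counit (R := R) (A := C)).rTensor W with he
  -- Apply the counit to the second factor `C` of the cotensor equation in `X ⊗ C ⊗ C ⊗ W`. The side
  -- with `Δ` returns `t`, the side with `ρ_X` lies in the image of `ρ_X ⊗ W`.
  have h := congrArg ((e.lTensor C).lTensor X.carrier) (mem_cotensor.1 ht)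
  rw [← assoc_lTensor, ← rTensor_lTensor_apply] at h
  rw [h, ← LinearMap.comp_apply, ← LinearMap.lTensor_comp]
  have h1 : e.lTensor C ∘ₗ (TensorProduct.assoc R C C W).toLinearMap ∘ₗ
      (Coalgebra.comul (R := R) (A := C)).rTensor W = LinearMap.id := by
    refine TensorProduct.ext' fun c w => ?_
    have h2 : ∀ s : C ⊗[R] C, e.lTensor C (TensorProduct.assoc R C C W (s ⊗ₜ w)) =
        (TensorProduct.rid R C ((Coalgebra.counit (R := R) (A := C)).lTensor C s)) ⊗ₜ w := by
      intro s
      induction s with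
      | zero => simp
      | add a b ha hb => simp only [add_tmul, map_add, ha, hb]
      | tmul a b => simp [he, smul_tmul]
    simp [h2]
  rw [h1, LinearMap.lTensor_id, LinearMap.id_apply]

/-- `ρ_X ⊗ W` takes values in `X □_C (C ⊗ W)`. -/
theorem rcoact_mem_cotensor (X : RComod R C) (W : Type u) [AddCommGroup W] [Module R W]
    (s : X.carrier ⊗[R] W) :
    TensorProduct.assoc R X.carrier C W (X.rcoact.rTensor W s) ∈
      cotensor X (LComod.tensorObj (Bicomod.self R C).toLComod W) := by
  refine mem_cotensor.2 ?_
  induction s with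
  | zero => simp
  | add a b ha hb => simp only [map_add, ha, hb]
  | tmul x w =>
    have h := congrArg (fun s => (TensorProduct.assoc R C C W).toLinearMap.lTensor X.carrier
      (TensorProduct.assoc R X.carrier (C ⊗[R] C) W (s ⊗ₜ[R] w))) (X.coassoc_apply x)
    have h1 : ∀ s : X.carrier ⊗[R] C,
      (TensorProduct.assoc R C C W).toLinearMap.lTensor X.carrier
        (TensorProduct.assoc R X.carrier (C ⊗[R] C) W
          (TensorProduct.assoc R X.carrier C C (X.rcoact.rTensor C s) ⊗ₜ[R] w)) =
      TensorProduct.assoc R X.carrier C (C ⊗[R] W) (X.rcoact.rTensor (C ⊗[R] W)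
        (TensorProduct.assoc R X.carrier C W (s ⊗ₜ w))) := by
      intro s
      induction s with
      | zero => simp
      | add a b ha hb => simp only [add_tmul, map_add, ha, hb]
      | tmul a c =>
        simp only [LinearMap.rTensor_tmul, assoc_tmul]
        induction X.rcoact a with
        | zero => simp
        | add a b ha hb => simp only [add_tmul, map_add, ha, hb]
        | tmul a d => simp
    have h2 : ∀ s : X.carrier ⊗[R] C,
      TensorProduct.assoc R X.carrier (C ⊗[R] C) W
        ((Coalgebra.comul (R := R) (A := C)).lTensor X.carrier s ⊗ₜ[R] w) =
      ((Coalgebra.comul (R := R) (A := C)).rTensor W).lTensor X.carrier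
        (TensorProduct.assoc R X.carrier C W (s ⊗ₜ w)) := fun s => by
      rw [← assoc_lTensor_rTensor, LinearMap.rTensor_tmul]
    simp only [h1, h2] at h
    rw [LinearMap.rTensor_tmul, LinearMap.lTensor_comp, LinearMap.comp_apply]
    exact h

/-- A comodule whose cotensor product with a faithfully coflat comodule vanishes is zero. -/
theorem IsFaithfullyCoflat.eq_zero {X : RComod R C} (hX : IsFaithfullyCoflat X)
    {K : LComod R C} (hK : ∀ t ∈ cotensor X K, t = 0) (k : K.carrier) : k = 0 := by
  have := hX.2
  let z : K ⟶ K := ⟨0, (LComod.colinear K K).zero_mem⟩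
  -- If `X □_C K` vanishes, the functor cannot distinguish the identity of `K` from zero; by
  -- faithfulness they coincide.
  have h : (cotensorFunctor X).map (𝟙 K) = (cotensorFunctor X).map z :=
    ModuleCat.hom_ext (LinearMap.ext fun t => Subtype.ext
      ((hK _ (Subtype.property _)).trans (hK _ (Subtype.property _)).symm))
  exact LinearMap.congr_fun (congrArg LComod.lin ((cotensorFunctor X).map_injective h)) k

/-- Coflat comodules are flat modules. -/
theorem IsCoflat.flat [Module.Flat R C] {X : RComod R C} (hX : IsCoflat X) :
    Module.Flat R X.carrier := by
  rw [Module.Flat.iff_lTensor_preserves_injective_linearMap]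
  intro W V _ _ _ _ f hf
  -- Coflatness is tested on the cofree sequence `C ⊗ W → C ⊗ V → C ⊗ (V / f(W))`, exact by flatness
  -- of `C`. As `X ⊗ W` embeds in `X □_C (C ⊗ W)` by `ρ_X ⊗ W`, injectivity there gives injectivity
  -- of `X ⊗ f`.
  have hj : Function.Injective (f.lTensor C) :=
    Module.Flat.lTensor_preserves_injective_linearMap _ hf
  have hex : Function.Exact (f.lTensor C) ((LinearMap.range f).mkQ.lTensor C) :=
    Module.Flat.lTensor_exact C (LinearMap.exact_map_mkQ_range f)
  have hs : Function.Surjective ((LinearMap.range f).mkQ.lTensor C) :=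
    LinearMap.lTensor_surjective _ (Submodule.mkQ_surjective _)
  obtain ⟨h, -⟩ := hX (N₁ := LComod.tensorObj (Bicomod.self R C).toLComod W)
    (N₂ := LComod.tensorObj (Bicomod.self R C).toLComod V)
    (N₃ := LComod.tensorObj (Bicomod.self R C).toLComod (V ⧸ LinearMap.range f))
    ⟨_, LComod.lTensor_mem f _⟩ ⟨_, LComod.lTensor_mem _ _⟩ hj hex hs
  rw [injective_iff_map_eq_zero]
  intro s hs0
  have h0 := (injective_iff_map_eq_zero _).1 h ⟨_, rcoact_mem_cotensor X W s⟩ (by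
    refine Subtype.ext ?_
    change (f.lTensor C).lTensor X.carrier
      (TensorProduct.assoc R X.carrier C W (X.rcoact.rTensor W s)) = 0
    rw [← assoc_lTensor, ← rTensor_lTensor_apply, hs0, map_zero, map_zero])
  have h1 := congrArg Subtype.val h0
  have h2 : Function.Injective (X.rcoact.rTensor W) := by
    have := X.rcoact_lTensor_injective W
    rwa [← LinearMap.lTensor_inj_iff_rTensor_inj]
  exact h2 ((TensorProduct.assoc R X.carrier C W).injective
    (h1.trans (map_zero _).symm |>.trans (congrArg _ (map_zero _).symm)))

end Comodules

/-! ### Exactness of the cohom functor. -/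

section CohomFunctor

variable {R C : Type u} [CommRing R] [AddCommGroup C] [Module R C] [Coalgebra R C]
variable {X : RComod R C} {h : RComod R C ⥤ ModuleCat.{u} R} (adj : h ⊣ tensorFunctor X)

/-- The linear map `h(f) : h(M) → h(N)` for a colinear map `f : M → N`. -/
def cohomMap {M N : RComod R C} (f : M.carrier →ₗ[R] N.carrier) (hf : f ∈ RComod.colinear M N) :
    h.obj M →ₗ[R] h.obj N :=
  desc adj (eta adj N ∘ₗ f) (RComod.comp_mem (eta_mem adj N) hf)

/-- Naturality of the unit. Together with `cohom_ext` it characterises `h(f)`, so identities between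
maps out of `h` are checked after composing with `η`. -/
theorem cohomMap_eta {M N : RComod R C} (f : M.carrier →ₗ[R] N.carrier)
    (hf : f ∈ RComod.colinear M N) (m : M.carrier) :
    (cohomMap adj f hf).rTensor X.carrier (eta adj M m) = eta adj N (f m) :=
  desc_apply adj _ _ m

theorem cohomMap_comp {M N P : RComod R C} {f : M.carrier →ₗ[R] N.carrier}
    (hf : f ∈ RComod.colinear M N) {g : N.carrier →ₗ[R] P.carrier} (hg : g ∈ RComod.colinear N P)
    (hgf : g ∘ₗ f ∈ RComod.colinear M P) :
    cohomMap adj g hg ∘ₗ cohomMap adj f hf = cohomMap adj (g ∘ₗ f) hgf :=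
  cohom_ext adj fun m => by
    rw [LinearMap.rTensor_comp_apply, cohomMap_eta, cohomMap_eta, cohomMap_eta,
      LinearMap.comp_apply]

theorem cohomMap_sub {M N : RComod R C} {f g : M.carrier →ₗ[R] N.carrier}
    (hf : f ∈ RComod.colinear M N) (hg : g ∈ RComod.colinear M N)
    (hfg : f - g ∈ RComod.colinear M N) :
    cohomMap adj (f - g) hfg = cohomMap adj f hf - cohomMap adj g hg :=
  cohom_ext adj fun m => by
    rw [LinearMap.rTensor_sub, LinearMap.sub_apply, cohomMap_eta, cohomMap_eta, cohomMap_eta,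
      LinearMap.sub_apply, map_sub]

theorem cohomMap_zero {M N : RComod R C} (h0 : (0 : M.carrier →ₗ[R] N.carrier) ∈
    RComod.colinear M N) : cohomMap adj 0 h0 = 0 :=
  cohom_ext adj fun m => by
    rw [cohomMap_eta, LinearMap.zero_apply, map_zero, LinearMap.rTensor_zero,
      LinearMap.zero_apply]

theorem cohomMap_id (M : RComod R C) (h1 : LinearMap.id ∈ RComod.colinear M M) :
    cohomMap adj LinearMap.id h1 = LinearMap.id :=
  cohom_ext adj fun m => by
    rw [cohomMap_eta, LinearMap.id_apply, LinearMap.rTensor_id, LinearMap.id_apply]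

/-- A colinear map that vanishes on the kernel of a surjective colinear map factors through it. -/
theorem RComod.exists_factor {N Q T : RComod R C} {p : N.carrier →ₗ[R] Q.carrier}
    (hp : p ∈ RComod.colinear N Q) (hps : Function.Surjective p)
    {s : N.carrier →ₗ[R] T.carrier} (hs : s ∈ RComod.colinear N T)
    (hle : LinearMap.ker p ≤ LinearMap.ker s) :
    ∃ s' ∈ RComod.colinear Q T, s' ∘ₗ p = s := by
  let s' : Q.carrier →ₗ[R] T.carrier :=
    (LinearMap.ker p).liftQ s hle ∘ₗ (p.quotKerEquivOfSurjective hps).symm.toLinearMap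
  have hs' : s' ∘ₗ p = s := LinearMap.ext fun n => by
    have : (p.quotKerEquivOfSurjective hps).symm (p n) = (LinearMap.ker p).mkQ n := by
      rw [LinearEquiv.symm_apply_eq]; rfl
    simp only [s', LinearMap.comp_apply, LinearEquiv.coe_coe, this]
    rfl
  clear_value s'
  refine ⟨s', LinearMap.ext fun y => ?_, hs'⟩
  obtain ⟨n, rfl⟩ := hps y
  rw [LinearMap.comp_apply, LinearMap.comp_apply, ← LinearMap.comp_apply s', hs',
    RComod.colinear_apply hp, ← LinearMap.rTensor_comp_apply, hs', RComod.colinear_apply hs]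

theorem RComod.mono_of_injective {M N : RComod R C} (f : M ⟶ N)
    (hf : Function.Injective (RComod.lin f)) : Mono f :=
  ⟨fun _ _ hab => Subtype.ext (LinearMap.ext fun x =>
    hf (LinearMap.congr_fun (congrArg Subtype.val hab) x))⟩

/-- If `X` is an injector then `h` preserves injective maps. -/
theorem cohomMap_injective (hinj : IsInjector X) {M N : RComod R C}
    {f : M.carrier →ₗ[R] N.carrier} (hf : f ∈ RComod.colinear M N)
    (hfi : Function.Injective f) : Function.Injective (cohomMap adj f hf) := by
  have : (tensorFunctor X).PreservesInjectiveObjects := hinj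
  let f' : M ⟶ N := ⟨f, hf⟩
  have : Mono f' := RComod.mono_of_injective f' hfi
  -- Embed `h(M)` in an injective module `I`. Then `I ⊗ X` is an injective comodule, so the
  -- transpose `M → I ⊗ X` of the embedding extends along `f` to `N`.
  let i := Injective.ι (h.obj M)
  have : Injective ((tensorFunctor X).obj (Injective.under (h.obj M))) :=
    (tensorFunctor X).injective_obj (Injective.under (h.obj M))
  let e : N ⟶ (tensorFunctor X).obj (Injective.under (h.obj M)) :=
    Injective.factorThru ((adj.homEquiv M _) i) f'
  have he : f' ≫ e = (adj.homEquiv M _) i := Injective.comp_factorThru _ _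
  have hi : Function.Injective i.hom := (ModuleCat.mono_iff_injective i).1 inferInstance
  -- Transposing the extension back shows that the embedding of `h(M)` factors through `h(f)`, which
  -- is therefore injective.
  have hc : desc adj (RComod.lin e) e.2 ∘ₗ cohomMap adj f hf = i.hom := by
    refine cohom_ext adj fun m => ?_
    rw [Adjunction.homEquiv_unit] at he
    rw [LinearMap.rTensor_comp_apply, cohomMap_eta]
    exact (desc_apply adj (RComod.lin e) e.2 (f m)).trans
      (LinearMap.congr_fun (congrArg RComod.lin he) m)
  have hi' : Function.Injective (desc adj (RComod.lin e) e.2 ∘ₗ cohomMap adj f hf) := by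
    rw [hc]; exact hi
  rw [LinearMap.coe_comp] at hi'
  exact hi'.of_comp

/-- The left adjoint `h` is right exact. -/
theorem cohomMap_ker_le {M N Q : RComod R C}
    {f : M.carrier →ₗ[R] N.carrier} (hf : f ∈ RComod.colinear M N)
    {p : N.carrier →ₗ[R] Q.carrier} (hp : p ∈ RComod.colinear N Q)
    (hps : Function.Surjective p) (hex : LinearMap.ker p = LinearMap.range f) :
    LinearMap.ker (cohomMap adj p hp) ≤ LinearMap.range (cohomMap adj f hf) := by
  -- The transpose of `q`, the quotient by the image of `h(f)`, kills the image of `f` and so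
  -- descends to `Q`. Transposing again, `q` factors through `h(p)`, whence `ker h(p) ≤ ker q`.
  let q := (LinearMap.range (cohomMap adj f hf)).mkQ
  let s : N.carrier →ₗ[R] (h.obj N ⧸ LinearMap.range (cohomMap adj f hf)) ⊗[R] X.carrier :=
    q.rTensor X.carrier ∘ₗ eta adj N
  have hs : s ∈ RComod.colinear N (RComod.tensorObj _ X) :=
    RComod.comp_mem (RComod.rTensor_mem q X) (eta_mem adj N)
  have hqf : q ∘ₗ cohomMap adj f hf = 0 := LinearMap.range_le_ker_iff.1 (by simp [q])
  have hsf : LinearMap.ker p ≤ LinearMap.ker s := by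
    rw [hex]
    rintro _ ⟨m, rfl⟩
    rw [LinearMap.mem_ker, LinearMap.comp_apply, ← cohomMap_eta adj f hf,
      ← LinearMap.rTensor_comp_apply, hqf, LinearMap.rTensor_zero, LinearMap.zero_apply]
  obtain ⟨s', hs'm, hs'⟩ := RComod.exists_factor hp hps hs hsf
  have hfac : desc adj s' hs'm ∘ₗ cohomMap adj p hp = q := by
    refine cohom_ext adj fun n => ?_
    rw [LinearMap.rTensor_comp_apply, cohomMap_eta, desc_apply, ← LinearMap.comp_apply, hs']
    rfl
  intro x hx
  have h0 : q x = 0 := by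
    rw [← hfac, LinearMap.comp_apply, LinearMap.mem_ker.1 hx, map_zero]
  simpa [q] using h0

/-- If `X` is an injector then `h` is left exact. -/
theorem cohomMap_ker (hinj : IsInjector X) {M N P : RComod R C}
    {f : M.carrier →ₗ[R] N.carrier} (hf : f ∈ RComod.colinear M N)
    {g : N.carrier →ₗ[R] P.carrier} (hg : g ∈ RComod.colinear N P)
    (hex : LinearMap.range f = LinearMap.ker g) :
    LinearMap.range (cohomMap adj f hf) = LinearMap.ker (cohomMap adj g hg) := by
  refine le_antisymm (LinearMap.range_le_ker_iff.2 ?_) ?_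
  · have h0 : g ∘ₗ f = 0 := LinearMap.range_le_ker_iff.1 hex.le
    rw [cohomMap_comp adj hf hg (RComod.comp_mem hg hf)]
    simp only [h0]
    exact cohomMap_zero adj _
  -- Factor `g` as the cokernel `p` of `f` followed by an injective `j`. Right exactness handles
  -- `h(p)`, and `h(j)` is injective, so `h(g)` and `h(p)` have the same kernel.
  · obtain ⟨Q, p, hp, hps, hpk⟩ := RComod.exists_cokernel hf
    have hpg : LinearMap.ker p = LinearMap.ker g := hpk.trans hex
    obtain ⟨j, hjm, hjp⟩ := RComod.exists_factor hp hps hg hpg.le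
    have hji : Function.Injective j := by
      rw [injective_iff_map_eq_zero]
      intro y hy
      obtain ⟨n, rfl⟩ := hps y
      rw [← LinearMap.comp_apply, hjp] at hy
      exact LinearMap.mem_ker.1 (hpg.ge (LinearMap.mem_ker.2 hy))
    refine le_trans (fun x hx => ?_) (cohomMap_ker_le adj hf hp hps hpk)
    refine cohomMap_injective adj hinj hjm hji ?_
    rw [map_zero, ← LinearMap.comp_apply, cohomMap_comp adj hp hjm (by rwa [hjp])]
    simp only [hjp]
    exact hx

/-! ### Compatibility of `h` with tensor products -/

/-- Applying `h` to these maps gives the inverse `W ⊗ h(M) → h(W ⊗ M)`, `w ⊗ e ↦ h(w ⊗ -)(e)`. -/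
theorem tensorHom_mem (W : Type u) [AddCommGroup W] [Module R W] (M : RComod R C) (w : W) :
    TensorProduct.mk R W M.carrier w ∈ RComod.colinear M (RComod.tensorObj W M) := by
  refine LinearMap.ext fun m => ?_
  simp only [LinearMap.comp_apply, LinearEquiv.coe_coe, TensorProduct.mk_apply,
    LinearMap.lTensor_tmul]
  induction M.rcoact m with
  | zero => simp
  | add a b ha hb => simp only [tmul_add, map_add, ha, hb]
  | tmul a c => simp

theorem tensorEta_mem (W : Type u) [AddCommGroup W] [Module R W] (M : RComod R C) :
    (TensorProduct.assoc R W (h.obj M) X.carrier).symm.toLinearMap ∘ₗ (eta adj M).lTensor W ∈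
      RComod.colinear (RComod.tensorObj W M) (RComod.tensorObj (W ⊗[R] h.obj M) X) :=
  RComod.comp_mem (N := RComod.tensorObj W (RComod.tensorObj (h.obj M) X))
    (RComod.assoc_symm_mem W (h.obj M) X) (RComod.lTensor_mem W (eta_mem adj M))

/-- The canonical map `h(W ⊗ M) → W ⊗ h(M)`. -/
def cohomTensor (W : Type u) [AddCommGroup W] [Module R W] (M : RComod R C) :
    h.obj (RComod.tensorObj W M) →ₗ[R] W ⊗[R] h.obj M :=
  desc adj _ (tensorEta_mem adj W M)

theorem cohomTensor_eta (W : Type u) [AddCommGroup W] [Module R W] (M : RComod R C)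
    (t : W ⊗[R] M.carrier) :
    (cohomTensor adj W M).rTensor X.carrier (eta adj (RComod.tensorObj W M) t) =
      (TensorProduct.assoc R W (h.obj M) X.carrier).symm ((eta adj M).lTensor W t) :=
  desc_apply adj _ (tensorEta_mem adj W M) t

/-- The inverse `W ⊗ h(M) → h(W ⊗ M)` of the canonical map. -/
def cohomTensorInv (W : Type u) [AddCommGroup W] [Module R W] (M : RComod R C) :
    W ⊗[R] h.obj M →ₗ[R] h.obj (RComod.tensorObj W M) :=
  TensorProduct.lift
    { toFun := fun w => cohomMap adj _ (tensorHom_mem W M w)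
      map_add' := fun w v => cohom_ext adj fun m => by
        rw [LinearMap.rTensor_add, LinearMap.add_apply, cohomMap_eta, cohomMap_eta, cohomMap_eta,
          map_add, LinearMap.add_apply, map_add]
      map_smul' := fun r w => cohom_ext adj fun m => by
        rw [LinearMap.rTensor_smul, LinearMap.smul_apply, cohomMap_eta, cohomMap_eta, map_smul,
          LinearMap.smul_apply, map_smul, RingHom.id_apply] }

theorem cohomTensorInv_mk (W : Type u) [AddCommGroup W] [Module R W] (M : RComod R C) (w : W) :
    cohomTensorInv adj W M ∘ₗ TensorProduct.mk R W (h.obj M) w =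
      cohomMap adj _ (tensorHom_mem W M w) := by
  refine LinearMap.ext fun e => ?_
  simp [cohomTensorInv]

theorem mk_rTensor (W A B : Type u) [AddCommGroup W] [Module R W] [AddCommGroup A] [Module R A]
    [AddCommGroup B] [Module R B] (w : W) (t : A ⊗[R] B) :
    (TensorProduct.mk R W A w).rTensor B t = (TensorProduct.assoc R W A B).symm (w ⊗ₜ t) := by
  induction t with
  | zero => simp
  | add a b ha hb => simp only [tmul_add, map_add, ha, hb]
  | tmul a b => simp

/-- Both modules represent the same functor of `V`: colinear maps `W ⊗ M → V ⊗ X` are linear maps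
from `W` to the colinear maps `M → V ⊗ X`, that is, to the linear maps `h(M) → V`. -/
theorem cohomTensor_bijective (W : Type u) [AddCommGroup W] [Module R W] (M : RComod R C) :
    Function.Bijective (cohomTensor adj W M) := by
  have h1 : cohomTensor adj W M ∘ₗ cohomTensorInv adj W M = LinearMap.id := by
    refine TensorProduct.ext (LinearMap.ext fun w => cohom_ext adj fun m => ?_)
    change ((cohomTensor adj W M ∘ₗ
      (cohomTensorInv adj W M ∘ₗ TensorProduct.mk R W (h.obj M) w))).rTensor X.carrier _ =
      (TensorProduct.mk R W (h.obj M) w).rTensor X.carrier _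
    rw [cohomTensorInv_mk, LinearMap.rTensor_comp_apply, cohomMap_eta, cohomTensor_eta,
      TensorProduct.mk_apply, LinearMap.lTensor_tmul, mk_rTensor]
  have h2 : cohomTensorInv adj W M ∘ₗ cohomTensor adj W M = LinearMap.id := by
    refine cohom_ext adj fun t => ?_
    rw [LinearMap.rTensor_comp_apply, cohomTensor_eta, LinearMap.rTensor_id, LinearMap.id_apply]
    change W ⊗[R] M.carrier at t
    induction t with
    | zero => simp
    | add a b ha hb => simp only [map_add, ha, hb]
    | tmul w m =>
      rw [LinearMap.lTensor_tmul, ← mk_rTensor, ← LinearMap.rTensor_comp_apply,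
        cohomTensorInv_mk, cohomMap_eta, TensorProduct.mk_apply]
  exact ⟨Function.LeftInverse.injective (g := cohomTensorInv adj W M) (LinearMap.congr_fun h2),
    Function.RightInverse.surjective (g := cohomTensorInv adj W M) (LinearMap.congr_fun h1)⟩

/-- Naturality in the comodule; it transfers injectivity of `h(W ⊗ f)` to `W ⊗ h(f)`. -/
theorem cohomTensor_lTensor (W : Type u) [AddCommGroup W] [Module R W] {M N : RComod R C}
    {f : M.carrier →ₗ[R] N.carrier} (hf : f ∈ RComod.colinear M N) :
    cohomTensor adj W N ∘ₗ cohomMap adj (f.lTensor W) (RComod.lTensor_mem W hf) =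
      (cohomMap adj f hf).lTensor W ∘ₗ cohomTensor adj W M := by
  refine cohom_ext adj fun t => ?_
  rw [LinearMap.rTensor_comp_apply, LinearMap.rTensor_comp_apply, cohomMap_eta, cohomTensor_eta,
    cohomTensor_eta, lTensor_rTensor_assoc_symm, ← LinearMap.lTensor_comp_apply,
    ← LinearMap.lTensor_comp_apply]
  congr 2
  exact LinearMap.congr_arg (f := LinearMap.lTensorHom W)
    (LinearMap.ext fun m => (cohomMap_eta adj f hf m).symm)

/-- Naturality in the module; it transfers injectivity of `h(g ⊗ M)` to `g ⊗ h(M)`, and thus yields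
flatness of `h(M)`. -/
theorem cohomTensor_rTensor {W V : Type u} [AddCommGroup W] [Module R W] [AddCommGroup V]
    [Module R V] (g : W →ₗ[R] V) (M : RComod R C) :
    cohomTensor adj V M ∘ₗ cohomMap adj (g.rTensor M.carrier) (RComod.rTensor_mem g M) =
      g.rTensor (h.obj M) ∘ₗ cohomTensor adj W M := by
  refine cohom_ext adj fun t => ?_
  rw [LinearMap.rTensor_comp_apply, LinearMap.rTensor_comp_apply, cohomMap_eta, cohomTensor_eta,
    cohomTensor_eta, rTensor_rTensor_assoc_symm, rTensor_lTensor_apply]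

/-- If `X` is an injector then `h(M)` is flat for every flat `M`. -/
theorem cohom_flat (adj : h ⊣ tensorFunctor X) (hinj : IsInjector X) (M : RComod R C) [Module.Flat R M.carrier] :
    Module.Flat R (h.obj M) := by
  rw [Module.Flat.iff_rTensor_preserves_injective_linearMap]
  intro W V _ _ _ _ g hg
  have h1 := cohomMap_injective adj hinj (RComod.rTensor_mem g M)
    (Module.Flat.rTensor_preserves_injective_linearMap g hg)
  have h2 := (cohomTensor_bijective adj V M).1.comp h1
  rw [← LinearMap.coe_comp, cohomTensor_rTensor, LinearMap.coe_comp] at h2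
  exact h2.of_comp_right (cohomTensor_bijective adj W M).2

/-- If `X` is an injector then `W ⊗ h(f)` is injective whenever `W ⊗ f` is. -/
theorem cohomMap_lTensor_injective (hinj : IsInjector X) (W : Type u) [AddCommGroup W]
    [Module R W] {M N : RComod R C} {f : M.carrier →ₗ[R] N.carrier}
    (hf : f ∈ RComod.colinear M N) (hfi : Function.Injective (f.lTensor W)) :
    Function.Injective ((cohomMap adj f hf).lTensor W) := by
  have h1 := cohomMap_injective adj hinj (RComod.lTensor_mem W hf) hfi
  have h2 := (cohomTensor_bijective adj W N).1.comp h1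
  rw [← LinearMap.coe_comp, cohomTensor_lTensor, LinearMap.coe_comp] at h2
  exact h2.of_comp_right (cohomTensor_bijective adj W M).2

/-- If `X` is an injector then `h(P □_D M) = P □_D h(M)`: here `M` is a `C`-comodule with a
colinear map `l : M → D ⊗ M`, the map `L : h(M) → D ⊗ h(M)` is induced by `l`, and
`i : K → P ⊗ M` is a kernel of `ρ_P ⊗ id - id ⊗ l`. -/
theorem cohomTensor_comp_cohomMap (hinj : IsInjector X) {D : Type u} [AddCommGroup D] [Module R D]
    [Coalgebra R D] (P : RComod R D) {M K : RComod R C} {l : M.carrier →ₗ[R] D ⊗[R] M.carrier}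
    (hl : l ∈ RComod.colinear M (RComod.tensorObj D M)) {L : h.obj M →ₗ[R] D ⊗[R] h.obj M}
    (hL : ∀ m, L.rTensor X.carrier (eta adj M m) =
      (TensorProduct.assoc R D (h.obj M) X.carrier).symm ((eta adj M).lTensor D (l m)))
    {i : K.carrier →ₗ[R] P.carrier ⊗[R] M.carrier}
    (hi : i ∈ RComod.colinear K (RComod.tensorObj P.carrier M)) (hii : Function.Injective i)
    (hir : ∀ t, t ∈ LinearMap.range i ↔
      TensorProduct.assoc R P.carrier D M.carrier (P.rcoact.rTensor M.carrier t) =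
        l.lTensor P.carrier t) :
    Function.Injective (cohomTensor adj P.carrier M ∘ₗ cohomMap adj i hi) ∧
    ∀ t, t ∈ LinearMap.range (cohomTensor adj P.carrier M ∘ₗ cohomMap adj i hi) ↔
      TensorProduct.assoc R P.carrier D (h.obj M) (P.rcoact.rTensor (h.obj M) t) =
        L.lTensor P.carrier t := by
  constructor
  · rw [LinearMap.coe_comp]
    exact (cohomTensor_bijective adj P.carrier M).1.comp (cohomMap_injective adj hinj hi hii)
  -- `K` is the kernel of the difference of the colinear maps `a` and `b`. The associator is moved
  -- into `b` so that both end in the comodule `(P ⊗ D) ⊗ M`. As `h` preserves this kernel, it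
  -- remains to identify `h(a)` and `h(b)`.
  let a := P.rcoact.rTensor M.carrier
  let b := (TensorProduct.assoc R P.carrier D M.carrier).symm.toLinearMap ∘ₗ l.lTensor P.carrier
  have ha : a ∈ RComod.colinear (RComod.tensorObj P.carrier M)
      (RComod.tensorObj (P.carrier ⊗[R] D) M) := RComod.rTensor_mem P.rcoact M
  have hb : b ∈ RComod.colinear (RComod.tensorObj P.carrier M)
      (RComod.tensorObj (P.carrier ⊗[R] D) M) :=
    RComod.comp_mem (N := RComod.tensorObj P.carrier (RComod.tensorObj D M))
      (RComod.assoc_symm_mem P.carrier D M) (RComod.lTensor_mem P.carrier hl)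
  have hab := (RComod.colinear (RComod.tensorObj P.carrier M)
      (RComod.tensorObj (P.carrier ⊗[R] D) M)).sub_mem ha hb
  have hex : LinearMap.range i = LinearMap.ker (a - b) := by
    ext t
    rw [hir, LinearMap.mem_ker, LinearMap.sub_apply, sub_eq_zero, LinearMap.comp_apply,
      LinearEquiv.coe_coe, LinearEquiv.eq_symm_apply]
  have hk := cohomMap_ker adj hinj hi hab hex
  have h1 : cohomTensor adj (P.carrier ⊗[R] D) M ∘ₗ cohomMap adj a ha =
      P.rcoact.rTensor (h.obj M) ∘ₗ cohomTensor adj P.carrier M := cohomTensor_rTensor adj P.rcoact M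
  -- Under `cohomTensor`, `h(a)` is `ρ_P ⊗ id` by naturality; `h(b)` is `id ⊗ L` by the equation
  -- `hL` that ties `L` to `l`.
  have h2 : cohomTensor adj (P.carrier ⊗[R] D) M ∘ₗ cohomMap adj b hb =
      (TensorProduct.assoc R P.carrier D (h.obj M)).symm.toLinearMap ∘ₗ L.lTensor P.carrier ∘ₗ
        cohomTensor adj P.carrier M := by
    refine cohom_ext adj fun t => ?_
    rw [LinearMap.rTensor_comp_apply, LinearMap.rTensor_comp_apply, LinearMap.rTensor_comp_apply,
      cohomMap_eta, cohomTensor_eta, cohomTensor_eta, lTensor_rTensor_assoc_symm]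
    change P.carrier ⊗[R] M.carrier at t
    induction t with
    | zero => simp
    | add a b ha hb => simp only [map_add, ha, hb]
    | tmul p m =>
      simp only [b, LinearMap.comp_apply, LinearMap.lTensor_tmul, LinearEquiv.coe_coe, hL]
      induction l m with
      | zero => simp
      | add a b ha hb => simp only [tmul_add, map_add, ha, hb]
      | tmul d m =>
        simp only [LinearMap.lTensor_tmul, assoc_symm_tmul]
        induction eta adj M m with
        | zero => simp
        | add a b ha hb => simp only [tmul_add, map_add, ha, hb]
        | tmul e x => simp
  have h3 : ∀ s : h.obj (RComod.tensorObj P.carrier M),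
      cohomMap adj (M := RComod.tensorObj P.carrier M)
        (N := RComod.tensorObj (P.carrier ⊗[R] D) M) (a - b) hab s = 0 ↔
      TensorProduct.assoc R P.carrier D (h.obj M)
        (P.rcoact.rTensor (h.obj M) (cohomTensor adj P.carrier M s)) =
        L.lTensor P.carrier (cohomTensor adj P.carrier M s) := by
    intro s
    rw [cohomMap_sub adj ha hb, LinearMap.sub_apply, sub_eq_zero,
      ← (cohomTensor_bijective adj (P.carrier ⊗[R] D) M).1.eq_iff]
    have e1 := LinearMap.congr_fun h1 s
    have e2 := LinearMap.congr_fun h2 s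
    simp only [LinearMap.comp_apply, LinearEquiv.coe_coe] at e1 e2
    rw [e1, e2, LinearEquiv.eq_symm_apply]
  intro t
  obtain ⟨s, rfl⟩ := (cohomTensor_bijective adj P.carrier M).2 t
  rw [← h3, ← LinearMap.mem_ker, ← hk]
  constructor
  · rintro ⟨k, hk⟩
    exact ⟨k, (cohomTensor_bijective adj P.carrier M).1 hk⟩
  · rintro ⟨k, hk⟩
    exact ⟨k, congrArg (cohomTensor adj P.carrier M) hk⟩

end CohomFunctor

/-! ### Bijectivity of the structure maps. -/

section Main

variable {R C : Type u} [CommRing R] [AddCommGroup C] [Module R C] [Coalgebra R C]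

/-- The coaction identifies `M` with `M □_C C`. -/
theorem RComod.mem_range_rcoact (M : RComod R C) (t : M.carrier ⊗[R] C) :
    t ∈ LinearMap.range M.rcoact ↔
      TensorProduct.assoc R M.carrier C C (M.rcoact.rTensor C t) =
        (Coalgebra.comul (R := R) (A := C)).lTensor M.carrier t := by
  constructor
  · rintro ⟨m, rfl⟩
    exact M.coassoc_apply m
  · intro ht
    have h1 : ∀ u : M.carrier ⊗[R] R, (TensorProduct.rid R C).toLinearMap.lTensor M.carrier
        (TensorProduct.assoc R M.carrier C R (M.rcoact.rTensor R u)) =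
        M.rcoact (TensorProduct.rid R M.carrier u) := by
      intro u
      induction u with
      | zero => simp
      | add a b ha hb => simp only [map_add, ha, hb]
      | tmul m r =>
        simp only [LinearMap.rTensor_tmul, TensorProduct.rid_tmul, map_smul]
        induction M.rcoact m with
        | zero => simp
        | add a b ha hb => simp only [add_tmul, map_add, ha, hb, smul_add]
        | tmul a c => simp
    have h2 : (TensorProduct.rid R C).toLinearMap ∘ₗ
        (Coalgebra.counit (R := R) (A := C)).lTensor C ∘ₗ Coalgebra.comul = LinearMap.id := by
      rw [Coalgebra.lTensor_counit_comp_comul]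
      ext; simp
    -- The preimage of `t` is `(id ⊗ ε) t`; applying `ε` to the last factor of the cotensor equation
    -- shows that its coaction is `t`.
    refine ⟨TensorProduct.rid R M.carrier
      ((Coalgebra.counit (R := R) (A := C)).lTensor M.carrier t), ?_⟩
    rw [← h1, rTensor_lTensor_apply, assoc_lTensor, ht, ← LinearMap.lTensor_comp_apply,
      ← LinearMap.lTensor_comp_apply, LinearMap.comp_assoc, h2, LinearMap.lTensor_id, LinearMap.id_apply]

/-- For an `R`-coalgebra `D`, a right `D`-comodule `P` and a right `C`-comodule `M` with a colinear
map `l : M → D ⊗ M`, the kernel of `ρ_P ⊗ id - id ⊗ l`, as a right `C`-comodule. -/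
theorem RComod.exists_cotensor [Module.Flat R C] {D : Type u} [AddCommGroup D] [Module R D]
    [Coalgebra R D] (P : RComod R D) {M : RComod R C} {l : M.carrier →ₗ[R] D ⊗[R] M.carrier}
    (hl : l ∈ RComod.colinear M (RComod.tensorObj D M)) :
    ∃ (K : RComod R C) (i : K.carrier →ₗ[R] P.carrier ⊗[R] M.carrier),
      i ∈ RComod.colinear K (RComod.tensorObj P.carrier M) ∧ Function.Injective i ∧
      ∀ t, t ∈ LinearMap.range i ↔
        TensorProduct.assoc R P.carrier D M.carrier (P.rcoact.rTensor M.carrier t) =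
          l.lTensor P.carrier t := by
  let a := P.rcoact.rTensor M.carrier
  let b := (TensorProduct.assoc R P.carrier D M.carrier).symm.toLinearMap ∘ₗ l.lTensor P.carrier
  have ha : a ∈ RComod.colinear (RComod.tensorObj P.carrier M)
      (RComod.tensorObj (P.carrier ⊗[R] D) M) := RComod.rTensor_mem P.rcoact M
  have hb : b ∈ RComod.colinear (RComod.tensorObj P.carrier M)
      (RComod.tensorObj (P.carrier ⊗[R] D) M) :=
    RComod.comp_mem (N := RComod.tensorObj P.carrier (RComod.tensorObj D M))
      (RComod.assoc_symm_mem P.carrier D M) (RComod.lTensor_mem P.carrier hl)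
  have hab := (RComod.colinear (RComod.tensorObj P.carrier M)
      (RComod.tensorObj (P.carrier ⊗[R] D) M)).sub_mem ha hb
  obtain ⟨K, i, hi, hii, hir⟩ := RComod.exists_kernel hab
  refine ⟨K, i, hi, hii, fun t => ?_⟩
  rw [hir, LinearMap.mem_ker, LinearMap.sub_apply, sub_eq_zero, LinearMap.comp_apply,
    LinearEquiv.coe_coe, LinearEquiv.eq_symm_apply]

variable {X : RComod R C} {h : RComod R C ⥤ ModuleCat.{u} R} (adj : h ⊣ tensorFunctor X)

/-- Since `ρ_M` presents `M` as the kernel `M □_C C`, this form lets exactness of `h` present `h(M)`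
as `M □_C h(C)`. -/
theorem deltaMap_eq (M : RComod R C) :
    deltaMap adj M = cohomTensor adj M.carrier (Bicomod.self R C).toRComod ∘ₗ
      cohomMap adj M.rcoact M.rcoact_mem := by
  refine cohom_ext adj fun m => ?_
  rw [deltaMap_eta, LinearMap.rTensor_comp_apply, cohomMap_eta, cohomTensor_eta]

theorem mem_cotensor_cohomSelf (M : RComod R C)
    (t : M.carrier ⊗[R] h.obj (Bicomod.self R C).toRComod) :
    t ∈ cotensor M (cohomSelf C adj).toLComod ↔
      TensorProduct.assoc R M.carrier C (h.obj (Bicomod.self R C).toRComod)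
        (M.rcoact.rTensor (h.obj (Bicomod.self R C).toRComod) t) =
      (lcoactMap adj (Bicomod.self R C)).lTensor M.carrier t :=
  mem_cotensor (M := M) (N := (cohomSelf C adj).toLComod) (t := t)

theorem mem_cotensor_coendBicomod (P : RComod R (Coend adj)) (t : P.carrier ⊗[R] X.carrier) :
    t ∈ cotensor P (coendBicomod adj).toLComod ↔
      TensorProduct.assoc R P.carrier (Coend adj) X.carrier (P.rcoact.rTensor X.carrier t) =
      (show X.carrier →ₗ[R] Coend adj ⊗[R] X.carrier from eta adj X).lTensor P.carrier t :=
  mem_cotensor (M := P) (N := (coendBicomod adj).toLComod) (t := t)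

/-- The map `δ_M` is injective with image `M □_C h(C)`. -/
theorem deltaMap_injective_and_range (hinj : IsInjector X) (M : RComod R C) :
    Function.Injective (deltaMap adj M) ∧
    ∀ t, t ∈ LinearMap.range (deltaMap adj M) ↔
      t ∈ cotensor M (cohomSelf C adj).toLComod := by
  have H := cohomTensor_comp_cohomMap adj hinj (D := C) M (M := (Bicomod.self R C).toRComod)
    (K := M) (l := (Bicomod.self R C).lcoact) (L := lcoactMap adj (Bicomod.self R C))
    (Bicomod.self R C).lcoact_mem (lcoactMap_eta adj (Bicomod.self R C))
    (i := M.rcoact) M.rcoact_mem M.rcoact_injective M.mem_range_rcoact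
  rw [← deltaMap_eq] at H
  exact ⟨H.1, fun t => (H.2 t).trans (mem_cotensor_cohomSelf adj M t).symm⟩

/-- The coaction `ρ_M` is split `R`-linearly, so it stays injective after tensoring with any `W`,
and `h` keeps this property. It yields the purity of `X □_C h(C)` and enters the injectivity of `η_C
⊗ W`. -/
theorem deltaMap_lTensor_injective (hinj : IsInjector X) (M : RComod R C) (W : Type u)
    [AddCommGroup W] [Module R W] : Function.Injective ((deltaMap adj M).lTensor W) := by
  rw [deltaMap_eq, LinearMap.lTensor_comp, LinearMap.coe_comp]
  refine Function.Injective.comp ?_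
    (cohomMap_lTensor_injective adj hinj W M.rcoact_mem (M.rcoact_lTensor_injective W))
  exact (LinearEquiv.lTensor W (LinearEquiv.ofBijective _
    (cohomTensor_bijective adj M.carrier (Bicomod.self R C).toRComod))).injective

theorem delta_bijective (hinj : IsInjector X) (M : RComod R C) :
    Function.Bijective (delta adj M) := by
  obtain ⟨h1, h2⟩ := deltaMap_injective_and_range adj hinj M
  refine ⟨fun a b hab => h1 (congrArg Subtype.val hab), fun t => ?_⟩
  obtain ⟨s, hs⟩ := (h2 t.1).2 t.2
  exact ⟨s, Subtype.ext hs⟩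

/-- If `V ≅ P` and the composite map to the ambient module is universally injective, then `P` is
pure. -/
theorem isPure_of_surjective {V A : Type u} [AddCommGroup V] [Module R V] [AddCommGroup A]
    [Module R A] {P : Submodule R V} (f : A →ₗ[R] P) (hf : Function.Surjective f)
    (H : ∀ (W : Type u) [AddCommGroup W] [Module R W],
      Function.Injective ((P.subtype ∘ₗ f).lTensor W)) : IsPure P := by
  intro W _ _
  have h1 : Function.Injective (P.subtype.rTensor W ∘ f.rTensor W) := by
    rw [← LinearMap.coe_comp, ← LinearMap.rTensor_comp]
    exact (LinearMap.lTensor_inj_iff_rTensor_inj _ _).1 (H W)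
  exact h1.of_comp_right (LinearMap.rTensor_surjective W hf)

/-- The equation defining the left coaction of `h(C)`, reassociated. It makes the kernel of `η_C ⊗
W` a left `C`-comodule, to which faithful coflatness applies. -/
theorem eta_mem_lcolinear : eta adj (Bicomod.self R C).toRComod ∈
    LComod.colinear (Bicomod.self R C).toLComod
      (LComod.tensorObj (cohomSelf C adj).toLComod X.carrier) := by
  refine LinearMap.ext fun c => ?_
  have h1 := congrArg (TensorProduct.assoc R C (h.obj (Bicomod.self R C).toRComod) X.carrier)
    (lcoactMap_eta adj (Bicomod.self R C) c)
  rw [LinearEquiv.apply_symm_apply] at h1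
  exact h1

theorem eta_self_rTensor_injective [Module.Flat R C] (hfc : IsFaithfullyCoflat X)
    (hinj : IsInjector X) (W : Type u) [AddCommGroup W] [Module R W] :
    Function.Injective ((eta adj (Bicomod.self R C).toRComod).rTensor W) := by
  have := hfc.1.flat
  obtain ⟨K, i, hi, hii, hir⟩ := LComod.exists_kernel
    (LComod.rTensor_mem (eta_mem_lcolinear adj) W)
  -- `K` is the kernel of `η_C ⊗ W`; it vanishes as soon as `X □_C K` does. `X` is flat, so `X □_C
  -- K` can be examined inside `X ⊗ (C ⊗ W)`.
  suffices hK : ∀ k : K.carrier, k = 0 by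
    rw [injective_iff_map_eq_zero]
    intro t ht
    obtain ⟨k, rfl⟩ : t ∈ LinearMap.range i := hir.ge ht
    rw [hK k, map_zero]
  refine hfc.eq_zero fun t ht => ?_
  have hXi : Function.Injective (i.lTensor X.carrier) :=
    Module.Flat.lTensor_preserves_injective_linearMap i hii
  refine hXi ?_
  rw [map_zero]
  have h1 := cotensor_map_mem X (⟨i, hi⟩ : K ⟶ _) t ht
  change i.lTensor X.carrier t ∈ _ at h1
  -- The image of `t` lies in `X □_C (C ⊗ W)`, hence is `(ρ_X ⊗ W) s`, while `X ⊗ η_C ⊗ W` kills it.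
  have h2 := eq_of_mem_cotensor_tensorObj_self X W h1
  set s := (((TensorProduct.lid R W).toLinearMap ∘ₗ
    (Coalgebra.counit (R := R) (A := C)).rTensor W).lTensor X.carrier)
      (i.lTensor X.carrier t) with hs
  have h3 : ((eta adj (Bicomod.self R C).toRComod).rTensor W).lTensor X.carrier
      (i.lTensor X.carrier t) = 0 := by
    rw [← LinearMap.lTensor_comp_apply]
    have h0 : (eta adj (Bicomod.self R C).toRComod).rTensor W ∘ₗ i = 0 :=
      LinearMap.range_le_ker_iff.1 hir.le
    rw [h0, LinearMap.lTensor_zero, LinearMap.zero_apply]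
  rw [h2, ← assoc_lTensor_rTensor, LinearEquiv.map_eq_zero_iff,
    ← LinearMap.rTensor_comp_apply] at h3
  have h4 : (eta adj (Bicomod.self R C).toRComod).lTensor X.carrier ∘ₗ X.rcoact =
      (TensorProduct.assoc R X.carrier (h.obj (Bicomod.self R C).toRComod) X.carrier).toLinearMap ∘ₗ
        (deltaMap adj X).rTensor X.carrier ∘ₗ eta adj X := by
    refine LinearMap.ext fun x => ?_
    simp only [LinearMap.comp_apply, deltaMap_eta, LinearEquiv.coe_coe,
      LinearEquiv.apply_symm_apply]
  -- By `h4` the map killing `s` is `(δ_X ⊗ id) η_X` tensored with `W`. Here `δ_X` is universally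
  -- injective, and `η_X`, being the left coaction of `E` on `X`, is split by the counit of `E`.
  have h5 : Function.Injective (((eta adj (Bicomod.self R C).toRComod).lTensor X.carrier ∘ₗ
      X.rcoact).rTensor W) := by
    rw [h4, LinearMap.rTensor_comp, LinearMap.rTensor_comp, LinearMap.coe_comp, LinearMap.coe_comp]
    refine Function.Injective.comp ?_ (Function.Injective.comp ?_ ?_)
    · exact (LinearEquiv.rTensor W (TensorProduct.assoc R X.carrier
        (h.obj (Bicomod.self R C).toRComod) X.carrier)).injective
    · have h6 : Function.Injective ((deltaMap adj X).rTensor (X.carrier ⊗[R] W)) :=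
        (LinearMap.lTensor_inj_iff_rTensor_inj _ _).1
          (deltaMap_lTensor_injective adj hinj X (X.carrier ⊗[R] W))
      intro a b hab
      refine (TensorProduct.assoc R (h.obj X) X.carrier W).injective (h6 ?_)
      rw [← assoc_rTensor_rTensor, ← assoc_rTensor_rTensor, hab]
    · exact (coendBicomod adj).toLComod.lcoact_rTensor_injective W
  have h6 : s = 0 := h5 (h3.trans (map_zero _).symm)
  rw [h2, h6, map_zero, map_zero]

/-- The unit `η_M` is injective. -/
theorem eta_injective [Module.Flat R C] (hfc : IsFaithfullyCoflat X) (hinj : IsInjector X)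
    (M : RComod R C) : Function.Injective (eta adj M) := by
  have h1 : Function.Injective ((eta adj (Bicomod.self R C).toRComod).lTensor M.carrier) :=
    (LinearMap.lTensor_inj_iff_rTensor_inj _ _).2
      (eta_self_rTensor_injective adj hfc hinj M.carrier)
  intro a b hab
  -- `(δ_M ⊗ id) η_M = (id ⊗ η_C) ρ_M`, and the right-hand side is injective by the case `W = M` of
  -- the previous theorem.
  have h2 := congrArg ((deltaMap adj M).rTensor X.carrier) hab
  rw [deltaMap_eta, deltaMap_eta] at h2
  exact M.rcoact_injective (h1 ((TensorProduct.assoc R _ _ _).symm.injective h2))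

/-- For a right `e_C(X)`-comodule `P` there is a `C`-comodule `K = P □ X` with `h(K) ≅ P`. -/
theorem exists_cohom_bijective [Module.Flat R C] (hinj : IsInjector X)
    (P : RComod R (Coend adj)) :
    ∃ (K : RComod R C) (i : K.carrier →ₗ[R] P.carrier ⊗[R] X.carrier)
      (hi : i ∈ RComod.colinear K (RComod.tensorObj P.carrier X)),
      (∀ t, t ∈ LinearMap.range i ↔ t ∈ cotensor P (coendBicomod adj).toLComod) ∧
      Function.Injective i ∧ Function.Bijective (desc adj i hi) := by
  let l : X.carrier →ₗ[R] Coend adj ⊗[R] X.carrier := eta adj X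
  let L : h.obj X →ₗ[R] Coend adj ⊗[R] h.obj X := coactMap adj X
  have hl : l ∈ RComod.colinear X (RComod.tensorObj (Coend adj) X) := eta_mem adj X
  obtain ⟨K, i, hi, hii, hir⟩ := RComod.exists_cotensor P hl
  refine ⟨K, i, hi, fun t => (hir t).trans (mem_cotensor_coendBicomod adj P t).symm, hii, ?_⟩
  -- Since `η_X` induces the comultiplication on `h(X) = E`, this embeds `h(K)` in `P ⊗ E` with
  -- image `P □_E E`, which is the image of `ρ_P`. The embedding is `ρ_P` after `desc adj i hi`, so
  -- the latter is bijective.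
  have H := cohomTensor_comp_cohomMap adj hinj P (M := X) (K := K) (l := l) (L := L) hl
    (coactMap_eta adj X) hi hii hir
  let ρ : P.carrier →ₗ[R] P.carrier ⊗[R] h.obj X := P.rcoact
  have e : cohomTensor adj P.carrier X ∘ₗ cohomMap adj i hi = ρ ∘ₗ desc adj i hi := by
    refine cohom_ext adj fun k => ?_
    rw [LinearMap.rTensor_comp_apply, cohomMap_eta, cohomTensor_eta, LinearMap.rTensor_comp_apply,
      desc_apply, LinearEquiv.symm_apply_eq]
    exact ((hir (i k)).1 ⟨k, rfl⟩).symm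
  have e' : ∀ k, cohomTensor adj P.carrier X (cohomMap adj i hi k) = P.rcoact (desc adj i hi k) :=
    LinearMap.congr_fun e
  constructor
  · intro x y hxy
    exact H.1 ((e' x).trans ((congrArg P.rcoact hxy).trans (e' y).symm))
  · intro p
    obtain ⟨k, hk⟩ := (H.2 (P.rcoact p)).2 (P.coassoc_apply p)
    exact ⟨k, P.rcoact_injective ((e' k).symm.trans hk)⟩

/-- The unit identifies `M` with `h(M) □ X`. -/
theorem mem_range_eta [Module.Flat R C] (hfc : IsFaithfullyCoflat X) (hinj : IsInjector X)
    (M : RComod R C) {t : h.obj M ⊗[R] X.carrier}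
    (ht : t ∈ cotensor (cohomRComod adj M) (coendBicomod adj).toLComod) :
    t ∈ LinearMap.range (eta adj M) := by
  obtain ⟨K, i, hi, hir, hii, hbij⟩ := exists_cohom_bijective adj hinj (cohomRComod adj M)
  obtain ⟨j, hj⟩ := exists_comp_eq_of_range_le hii (f := eta adj M) (by
    rintro _ ⟨m, rfl⟩
    exact (hir _).2 (etaCotensor adj M m).2)
  have hjm : j ∈ RComod.colinear M K := by
    have hi' : Function.Injective (i.rTensor C) :=
      Module.Flat.rTensor_preserves_injective_linearMap i hii
    refine LinearMap.ext fun m => hi' ?_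
    rw [LinearMap.comp_apply, LinearMap.comp_apply, ← RComod.colinear_apply hi,
      ← LinearMap.rTensor_comp_apply, hj, ← LinearMap.comp_apply i, hj]
    exact RComod.colinear_apply (eta_mem adj M) m
  have hφ : desc adj i hi ∘ₗ cohomMap adj j hjm = LinearMap.id := by
    refine cohom_ext adj fun m => ?_
    rw [LinearMap.rTensor_comp_apply, cohomMap_eta, desc_apply, ← LinearMap.comp_apply, hj]
    exact (LinearMap.congr_fun (LinearMap.rTensor_id X.carrier (h.obj M)) (eta adj M m)).symm
  -- `h(j)` is a right inverse of the bijection `h(K) → h(M)`, hence surjective.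
  have hjs : Function.Surjective (cohomMap adj j hjm) := by
    intro y
    exact ⟨desc adj i hi y, hbij.1 (LinearMap.congr_fun hφ (desc adj i hi y))⟩
  obtain ⟨Q, p, hp, hps, hpk⟩ := RComod.exists_cokernel hjm
  have hp0 : cohomMap adj p hp = 0 := by
    have h0 : p ∘ₗ j = 0 := LinearMap.range_le_ker_iff.1 hpk.ge
    have h1 := cohomMap_comp adj hjm hp (RComod.comp_mem hp hjm)
    simp only [h0] at h1
    rw [cohomMap_zero] at h1
    refine LinearMap.ext fun y => ?_
    obtain ⟨x, rfl⟩ := hjs y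
    exact LinearMap.congr_fun h1 x
  obtain ⟨k, rfl⟩ := (hir t).2 ht
  -- `h(p) = 0` forces `η_Q p = (h(p) ⊗ id) η_K = 0`, and `η_Q` is injective. So the cokernel of `j`
  -- vanishes.
  have hk : p k = 0 := eta_injective adj hfc hinj Q (by
    rw [← cohomMap_eta adj p hp, hp0, LinearMap.rTensor_zero, LinearMap.zero_apply, map_zero])
  obtain ⟨m, rfl⟩ : k ∈ LinearMap.range j := hpk.le hk
  exact ⟨m, (LinearMap.congr_fun hj m).symm⟩

theorem etaCotensor_bijective [Module.Flat R C] (hfc : IsFaithfullyCoflat X)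
    (hinj : IsInjector X) (M : RComod R C) : Function.Bijective (etaCotensor adj M) := by
  refine ⟨fun a b hab => eta_injective adj hfc hinj M (congrArg Subtype.val hab), fun t => ?_⟩
  obtain ⟨m, hm⟩ := mem_range_eta adj hfc hinj M t.2
  exact ⟨m, Subtype.ext hm⟩

/-! ### Bicolinearity of the structure maps and the two diagrams -/

/-- The pentagon identity, applied to an element. -/
theorem assoc_rTensor_assoc_symm {A B D E : Type*} [AddCommGroup A] [Module R A]
    [AddCommGroup B] [Module R B] [AddCommGroup D] [Module R D] [AddCommGroup E] [Module R E]
    (v : A ⊗[R] (B ⊗[R] (D ⊗[R] E))) :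
    (TensorProduct.assoc R A B D).toLinearMap.rTensor E
        ((TensorProduct.assoc R (A ⊗[R] B) D E).symm
          ((TensorProduct.assoc R A B (D ⊗[R] E)).symm v)) =
      (TensorProduct.assoc R A (B ⊗[R] D) E).symm
        ((TensorProduct.assoc R B D E).symm.toLinearMap.lTensor A v) := by
  have h : (TensorProduct.assoc R A B D).toLinearMap.rTensor E ∘ₗ
      (TensorProduct.assoc R (A ⊗[R] B) D E).symm.toLinearMap ∘ₗ
        (TensorProduct.assoc R A B (D ⊗[R] E)).symm.toLinearMap =
      (TensorProduct.assoc R A (B ⊗[R] D) E).symm.toLinearMap ∘ₗ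
        (TensorProduct.assoc R B D E).symm.toLinearMap.lTensor A := by
    ext; simp
  exact LinearMap.congr_fun h v

theorem deltaMap_rTensor_comp_eta (M : RComod R C) :
    (deltaMap adj M).rTensor X.carrier ∘ₗ eta adj M =
      (TensorProduct.assoc R M.carrier (h.obj (Bicomod.self R C).toRComod)
        X.carrier).symm.toLinearMap ∘ₗ
        (eta adj (Bicomod.self R C).toRComod).lTensor M.carrier ∘ₗ M.rcoact :=
  LinearMap.ext (deltaMap_eta adj M)

theorem coactMap_rTensor_comp_eta (M : RComod R C) :
    (coactMap adj M).rTensor X.carrier ∘ₗ eta adj M =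
      (TensorProduct.assoc R (h.obj M) (h.obj X) X.carrier).symm.toLinearMap ∘ₗ
        (eta adj X).lTensor (h.obj M) ∘ₗ eta adj M :=
  LinearMap.ext (coactMap_eta adj M)

/-- Composed with `η_M`, both sides become `(id ⊗ (id ⊗ η_C) ρ_X) η_M`, by `C`-colinearity of `η_M`.
The case `M = X` is left colinearity of `δ_X`; the case `M = C` is the diagram for `h(C)`. -/
theorem eta_rTensor_deltaMap (M : RComod R C) :
    (TensorProduct.assoc R (h.obj M) X.carrier
      (h.obj (Bicomod.self R C).toRComod)).toLinearMap ∘ₗ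
        (eta adj M).rTensor (h.obj (Bicomod.self R C).toRComod) ∘ₗ deltaMap adj M =
      (deltaMap adj X).lTensor (h.obj M) ∘ₗ coactMap adj M := by
  refine cohom_ext adj fun m => ?_
  have h1 : (eta adj M).rTensor C (M.rcoact m) =
      (TensorProduct.assoc R (h.obj M) X.carrier C).symm
        (X.rcoact.lTensor (h.obj M) (eta adj M m)) :=
    (RComod.colinear_apply (eta_mem adj M) m).symm
  rw [LinearMap.rTensor_comp_apply, LinearMap.rTensor_comp_apply, LinearMap.rTensor_comp_apply,
    deltaMap_eta, coactMap_eta, rTensor_rTensor_assoc_symm, lTensor_rTensor_assoc_symm,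
    ← LinearMap.lTensor_comp_apply, deltaMap_rTensor_comp_eta, rTensor_lTensor_apply, h1,
    lTensor_assoc_symm, assoc_rTensor_assoc_symm, ← LinearMap.lTensor_comp_apply,
    ← LinearMap.lTensor_comp_apply, LinearMap.comp_assoc]

/-- Composed with `η_M`, both sides become `(id ⊗ (id ⊗ η_X) η_C) ρ_M`. The case `M = X` is right
colinearity of `δ_X`. -/
theorem coactMap_lTensor_deltaMap (M : RComod R C) :
    (coactMap adj (Bicomod.self R C).toRComod).lTensor M.carrier ∘ₗ deltaMap adj M =
      (TensorProduct.assoc R M.carrier (h.obj (Bicomod.self R C).toRComod)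
        (h.obj X)).toLinearMap ∘ₗ (deltaMap adj M).rTensor (h.obj X) ∘ₗ coactMap adj M := by
  refine cohom_ext adj fun m => ?_
  rw [LinearMap.rTensor_comp_apply, LinearMap.rTensor_comp_apply, LinearMap.rTensor_comp_apply,
    deltaMap_eta, coactMap_eta, lTensor_rTensor_assoc_symm, rTensor_rTensor_assoc_symm,
    rTensor_lTensor_apply, deltaMap_eta, lTensor_assoc_symm, assoc_rTensor_assoc_symm,
    ← LinearMap.lTensor_comp_apply, ← LinearMap.lTensor_comp_apply,
    ← LinearMap.lTensor_comp_apply, coactMap_rTensor_comp_eta, LinearMap.comp_assoc]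

/-- For `M = C` the two maps have the same defining equation. -/
theorem deltaMap_self :
    deltaMap adj (Bicomod.self R C).toRComod = lcoactMap adj (Bicomod.self R C) :=
  cohom_ext adj fun m => by rw [deltaMap_eta, lcoactMap_eta]

/-! ### The equivalence of comodule categories -/

theorem cohomMap_mem {M N : RComod R C} {f : M.carrier →ₗ[R] N.carrier}
    (hf : f ∈ RComod.colinear M N) :
    coactMap adj N ∘ₗ cohomMap adj f hf =
      (cohomMap adj f hf).rTensor (h.obj X) ∘ₗ coactMap adj M := by
  refine cohom_ext adj fun m => ?_
  rw [LinearMap.rTensor_comp_apply, LinearMap.rTensor_comp_apply, cohomMap_eta, coactMap_eta,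
    coactMap_eta, rTensor_rTensor_assoc_symm, rTensor_lTensor_apply, cohomMap_eta]

/-- The functor `h` with values in the category of right `e_C(X)`-comodules. -/
def cohomFunctor : RComod R C ⥤ RComod R (Coend adj) where
  obj M := cohomRComod adj M
  map f := ⟨cohomMap adj f.1 f.2, cohomMap_mem adj f.2⟩
  map_id M := Subtype.ext (cohomMap_id adj M M.id_mem)
  map_comp f g := Subtype.ext (cohomMap_comp adj f.2 g.2 (RComod.comp_mem g.2 f.2)).symm

instance : (cohomFunctor adj).Additive where
  map_add {M N f g} := Subtype.ext (cohom_ext adj fun m => by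
    change (cohomMap adj (f + g).1 (f + g).2).rTensor X.carrier (eta adj M m) =
      (cohomMap adj f.1 f.2 + cohomMap adj g.1 g.2).rTensor X.carrier (eta adj M m)
    rw [LinearMap.rTensor_add, LinearMap.add_apply, cohomMap_eta, cohomMap_eta, cohomMap_eta,
      ← map_add]
    rfl)

instance : (cohomFunctor adj).Linear R where
  map_smul {M N} f r := Subtype.ext (cohom_ext adj fun m => by
    change (cohomMap adj (r • f).1 (r • f).2).rTensor X.carrier (eta adj M m) =
      (r • cohomMap adj f.1 f.2).rTensor X.carrier (eta adj M m)
    rw [LinearMap.rTensor_smul, LinearMap.smul_apply, cohomMap_eta, cohomMap_eta, ← map_smul]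
    rfl)

theorem cohomFunctor_faithful [Module.Flat R C] (hfc : IsFaithfullyCoflat X)
    (hinj : IsInjector X) : (cohomFunctor adj).Faithful where
  map_injective {M N f g} hfg := by
    have h1 : cohomMap adj f.1 f.2 = cohomMap adj g.1 g.2 := congrArg Subtype.val hfg
    refine Subtype.ext (LinearMap.ext fun m => eta_injective adj hfc hinj N ?_)
    -- By naturality `h(f)` determines `η_N f`, hence `f`.
    rw [← cohomMap_eta adj f.1 f.2, h1, cohomMap_eta]

theorem cohomFunctor_full [Module.Flat R C] (hfc : IsFaithfullyCoflat X)
    (hinj : IsInjector X) : (cohomFunctor adj).Full where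
  map_surjective {M N} g := by
    let g' : h.obj M →ₗ[R] h.obj N := g.1
    have hg : coactMap adj N ∘ₗ g' = g'.rTensor (h.obj X) ∘ₗ coactMap adj M := g.2
    -- `E`-colinearity of `g` says that `(g ⊗ X) η_M` lands in `h(N) □_E X`, the image of `η_N`, so
    -- it lifts to a map `f : M → N` with `h(f) = g`.
    obtain ⟨f, hf⟩ := exists_comp_eq_of_range_le (eta_injective adj hfc hinj N)
      (f := g'.rTensor X.carrier ∘ₗ eta adj M) (by
        rintro _ ⟨m, rfl⟩
        refine mem_range_eta adj hfc hinj N ((mem_cotensor_coendBicomod adj _ _).2 ?_)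
        change TensorProduct.assoc R (h.obj N) (h.obj X) X.carrier
          ((coactMap adj N).rTensor X.carrier (g'.rTensor X.carrier (eta adj M m))) =
          (eta adj X).lTensor (h.obj N) (g'.rTensor X.carrier (eta adj M m))
        rw [← LinearMap.rTensor_comp_apply, hg, LinearMap.rTensor_comp_apply, coactMap_eta,
          rTensor_rTensor_assoc_symm, LinearEquiv.apply_symm_apply, rTensor_lTensor_apply])
    have hfm : f ∈ RComod.colinear M N := by
      -- Colinearity of the lift is checked after `η_N ⊗ C`, injective because `C` is flat.
      have hi : Function.Injective ((eta adj N).rTensor C) :=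
        Module.Flat.rTensor_preserves_injective_linearMap _ (eta_injective adj hfc hinj N)
      have hm := RComod.comp_mem (RComod.rTensor_mem g' X) (eta_mem adj M)
      rw [← hf] at hm
      refine LinearMap.ext fun m => hi ?_
      rw [LinearMap.comp_apply, LinearMap.comp_apply,
        ← RComod.colinear_apply (eta_mem adj N), ← LinearMap.rTensor_comp_apply]
      exact RComod.colinear_apply hm m
    refine ⟨⟨f, hfm⟩, Subtype.ext (cohom_ext adj (q := g') fun m => ?_)⟩
    exact (cohomMap_eta adj f hfm m).trans (LinearMap.congr_fun hf m)

theorem RComod.nonempty_iso_of_bijective {M N : RComod R C} {f : M.carrier →ₗ[R] N.carrier}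
    (hf : f ∈ RComod.colinear M N) (hb : Function.Bijective f) : Nonempty (M ≅ N) := by
  let e := LinearEquiv.ofBijective f hb
  have h1 : e.symm.toLinearMap ∘ₗ f = LinearMap.id := LinearMap.ext e.symm_apply_apply
  have h2 : f ∘ₗ e.symm.toLinearMap = LinearMap.id := LinearMap.ext e.apply_symm_apply
  have he : e.symm.toLinearMap ∈ RComod.colinear N M := by
    refine LinearMap.ext fun y => ?_
    obtain ⟨x, rfl⟩ := hb.2 y
    rw [LinearMap.comp_apply, LinearMap.comp_apply, RComod.colinear_apply hf,
      ← LinearMap.rTensor_comp_apply, h1, LinearMap.rTensor_id, LinearMap.id_apply,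
      ← LinearMap.comp_apply _ f, h1, LinearMap.id_apply]
  exact ⟨⟨⟨f, hf⟩, ⟨_, he⟩, Subtype.ext h1, Subtype.ext h2⟩⟩

theorem cohomFunctor_essSurj [Module.Flat R C] (hinj : IsInjector X) :
    (cohomFunctor adj).EssSurj where
  mem_essImage P := by
    obtain ⟨K, i, hi, hir, -, hbij⟩ := exists_cohom_bijective adj hinj P
    refine ⟨K, RComod.nonempty_iso_of_bijective (M := cohomRComod adj K) (f := desc adj i hi)
      ?_ hbij⟩
    let ρ : P.carrier →ₗ[R] P.carrier ⊗[R] h.obj X := P.rcoact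
    change ρ ∘ₗ desc adj i hi = (desc adj i hi).rTensor (h.obj X) ∘ₗ coactMap adj K
    refine cohom_ext adj fun k => ?_
    -- The preimage of `P` is `K = P □_E X`; colinearity of the bijection `h(K) → P` is the cotensor
    -- equation satisfied by `i k`.
    have h1 := (mem_cotensor_coendBicomod adj P (i k)).1 ((hir _).1 ⟨k, rfl⟩)
    rw [LinearMap.rTensor_comp_apply, LinearMap.rTensor_comp_apply, desc_apply, coactMap_eta,
      rTensor_rTensor_assoc_symm, rTensor_lTensor_apply, desc_apply, LinearEquiv.eq_symm_apply]
    exact h1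

theorem moritaTakeuchiEquivalent_coend [Module.Flat R C] (hfc : IsFaithfullyCoflat X)
    (hinj : IsInjector X) : MoritaTakeuchiEquivalent R C (Coend adj) := by
  have := cohomFunctor_faithful adj hfc hinj
  have := cohomFunctor_full adj hfc hinj
  have := cohomFunctor_essSurj adj hinj
  have : (cohomFunctor adj).IsEquivalence := { }
  exact ⟨(cohomFunctor adj).asEquivalence, inferInstanceAs (cohomFunctor adj).Additive,
    inferInstanceAs ((cohomFunctor adj).Linear R)⟩

theorem isStrictContext_coend [Module.Flat R C] (hfc : IsFaithfullyCoflat X)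
    (hinj : IsInjector X) :
    IsStrictContext (D := Coend adj) (C := C) (coendBicomod adj) (cohomSelf C adj)
      (delta adj X) (etaCotensor adj (Bicomod.self R C).toRComod) where
  flat_left := by
    have := hfc.1.flat
    exact cohom_flat adj hinj X
  flat_right := inferInstance
  bicolinear_f := ⟨eta_rTensor_deltaMap adj X, by
    refine LinearMap.ext fun x => ?_
    exact (LinearEquiv.symm_apply_eq (TensorProduct.assoc R X.carrier
      (h.obj (Bicomod.self R C).toRComod) (h.obj X))).2
        (LinearMap.congr_fun (coactMap_lTensor_deltaMap adj X) x)⟩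
  bicolinear_g := ⟨eta_mem_lcolinear adj, eta_mem adj _⟩
  flat_M := hfc.1.flat
  flat_N := cohom_flat adj hinj (Bicomod.self R C).toRComod
  -- Each cotensor product is the image of a universally injective map, `δ_X` here and `η_C` below,
  -- and is therefore pure.
  pure_MN := isPure_of_surjective _ (delta_bijective adj hinj X).2
    fun W _ _ => deltaMap_lTensor_injective adj hinj X W
  pure_NM := isPure_of_surjective _
    (etaCotensor_bijective adj hfc hinj (Bicomod.self R C).toRComod).2
    fun W _ _ => (LinearMap.lTensor_inj_iff_rTensor_inj _ _).2
      (eta_self_rTensor_injective adj hfc hinj W)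
  diagram_M := by
    refine LinearMap.ext fun x => ?_
    -- The diagram for `X` is the equation defining `δ_X`.
    have h1 := deltaMap_eta adj X x
    rw [LinearEquiv.eq_symm_apply] at h1
    exact h1.symm
  diagram_N := by
    -- The left coaction of `h(C)` is `δ_C`, so the diagram for `h(C)` is this identity at `M = C`.
    have h1 := eta_rTensor_deltaMap adj (Bicomod.self R C).toRComod
    rw [deltaMap_self] at h1
    exact h1.symm
  bijective_f := delta_bijective adj hinj X
  bijective_g := etaCotensor_bijective adj hfc hinj (Bicomod.self R C).toRComod

end Main

end

end MoritaTakeuchi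

theorem mainTheorem9 (R C : Type u) [CommRing R] [AddCommGroup C] [Module R C] [Coalgebra R C]
    [Module.Flat R C] (X : MoritaTakeuchi.RComod R C)
    (hqf : MoritaTakeuchi.IsQuasiFinite X) (hfc : MoritaTakeuchi.IsFaithfullyCoflat X)
    (hinj : MoritaTakeuchi.IsInjector X)
    -- any choice of the cohom functor, i.e. of a left adjoint of `- ⊗ X`
    (h : CategoryTheory.Functor (MoritaTakeuchi.RComod R C) (ModuleCat.{u} R))
    (adj : h ⊣ MoritaTakeuchi.tensorFunctor X) :
    MoritaTakeuchi.IsStrictContext (D := MoritaTakeuchi.Coend adj) (C := C)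
      (MoritaTakeuchi.coendBicomod adj) (MoritaTakeuchi.cohomSelf C adj)
      (MoritaTakeuchi.delta adj X)
      (MoritaTakeuchi.etaCotensor adj (MoritaTakeuchi.Bicomod.self R C).toRComod) ∧
    MoritaTakeuchi.MoritaTakeuchiEquivalent R C (MoritaTakeuchi.Coend adj) :=
  ⟨MoritaTakeuchi.isStrictContext_coend adj hfc hinj,
    MoritaTakeuchi.moritaTakeuchiEquivalent_coend adj hfc hinj⟩
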